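/- **Setting.** Let $M$ be a compact connected Riemannian manifold of finite dimension $d$, with Riemannian distance and its Borel $\sigma$-algebra, and let $\mathrm{Leb}$ be a normalised volume on $M$ (a probability measure which in charts has a continuous positive density). Let $f:M\to M$ be continuous on a set $Y$ of full $\mathrm{Leb}$-measure, and suppose there is $x_0\in M$ such that $\{f^nx_0:n\ge 0\}$ is dense in $M$ and contained in $Y$. Let $\mu$ be a Borel probability measure on $M$. Suppose that one of the following holds. (a) *Random maps.* $X$ is a compact metric space, $\theta$ is a Borel probability measure on $X$, $\omega^*\in X$, $\operatorname{supp}\theta$ contains a ball of positive radius around $\omega^*$, and $F:M\times X\to M$ is measurable. Write $f_\omega(x)=f^x(\omega)=F(x,\omega)$. Assume $f_{\omega^*}=f$, and that there are constants $\rho_0>0$ and $\overline q>\underline q>0$ such that for $\mathrm{Leb}$-a.e. $x$: $\operatorname{supp}\big((f^x)_*\theta\big)\supset B_{\rho_0}(f(x))$, and $(f^x)_*\theta=q_x\,\mathrm{Leb}$ with $\underline q\le q_x\le\overline q$ $\mathrm{Leb}$-a.e. on $\operatorname{supp}\big((f^x)_*\theta\big)$. Assume also that $(f^x)_*\theta\ll\mathrm{Leb}$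 for $\mu$-a.e. $x$, and that $\mu$ is stationary: $\iint g\circ f_\omega\,d\mu\,d\theta(\omega)=\int g\,d\mu$ for every $\mu$-integrable $g:M\to\mathbb R$. Put $Z_0(x,\underline\omega)=x$ and $Z_n(x,\underline\omega)=f_{\omega_n}\circ\cdots\circ f_{\omega_1}(x)$ on the probability space $(M\times X^{\mathbb N},\ \mathbb P=\mu\times\theta^{\mathbb N})$. (b) *Markov chain.* $(p_x)_{x\in M}$ is a family of transition probabilities $p_x=q_x\,\mathrm{Leb}$, where each $q_x$ is a positive probability density, Hölder continuous for some exponent $\alpha>0$, $x\mapsto q_x$ is continuous in the $C^0$-topology, and there are $\rho_0>0$, $\overline q>\underline q>0$ with $\operatorname{supp}q_x\supset B_{\rho_0}(f(x))$ and $\underline q\le q_x\le\overline q$ for all $x\in Y$. The measure $\mu$ is stationary, $\int p_x(A)\,d\mu(x)=\mu(A)$ for all Borel $A$, and $Z_0,Z_1,\dots$ is a Markov chain with transition probabilities $(p_x)$ and initial law $\mu$ on a probability space with probability $\mathbb P$. Let $\zeta\in M$ and let $\varphi:M\to\mathbb R\cup\{\pm\infty\}$ be measurable with a global maximum at $\zeta$,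 such that for $u<\varphi(\zeta)$ sufficiently close to $\varphi(\zeta)$ the set $\{\varphi>u\}$ is a topological ball centred at $\zeta$ (the image of the open unit ball of $\mathbb R^d$ under a homeomorphism taking $0$ to $\zeta$), and such that $u\mapsto\mu\{\varphi>u\}$ is continuous in a neighbourhood of $\varphi(\zeta)$. Put $X_n=\varphi(Z_n)$, and let $(u_n)$ be a sequence of real numbers with $n\,\mathbb P(X_0>u_n)\to\tau$ for some $\tau>0$. Let $\mathcal R$ be the ring of finite unions of intervals $[a,b)$ with $a,b\in[0,\infty)$. For $A\subset\mathbb R$ put $\mathscr N_u(A)=\sum_{i\in A\cap\mathbb N_0}\mathbf 1_{\{X_i>u\}}$, and let $N_n(J)=\mathscr N_{u_n}(v_nJ)$ with $v_n=1/\mathbb P(X_0>u_n)$ for $J\in\mathcal R$ (the rare event point process). **Conclusion.** 1. $D_3(u_n)$ holds: there are a function $\gamma(n,t)$, nonincreasing in $t$ for each $n$, and integers $t_n\ge0$ with $t_n=o(n)$ and $n\gamma(n,t_n)\to0$, such that for all $A\in\mathcal R$ and all $n,t\in\mathbb N_0$, $$\big|\mathbb P\big(X_0>u_n,\ \mathscr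 N_{u_n}(A+t)=0\big)-\mathbb P(X_0>u_n)\,\mathbb P\big(\mathscr N_{u_n}(A)=0\big)\big|\le\gamma(n,t).$$ 2. $D'(u_n)$ holds: for every sequence $(t_n)$ as in 1 there are integers $k_n\to\infty$ with $k_nt_n=o(n)$ and $$\lim_{n\to\infty}n\sum_{j=1}^{\lfloor n/k_n\rfloor}\mathbb P(X_0>u_n,\ X_j>u_n)=0.$$ 3. $N_n$ converges in distribution to a Poisson process $N$ on $[0,\infty)$ of intensity $1$: for all $k$ and $J_1,\dots,J_k\in\mathcal R$, the random vectors $(N_n(J_1),\dots,N_n(J_k))$ converge in distribution to $(N(J_1),\dots,N(J_k))$. -/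

import Mathlib

open MeasureTheory ProbabilityTheory Filter Set
open scoped Topology ENNReal NNReal Manifold Bundle

noncomputable section

namespace RareEvents

/-! ### Lebesgue measure on a manifold -/

/-- `m` is the measure of a (continuous, nowhere vanishing) volume form, i.e. of a positive
density: in every preferred chart it is Lebesgue measure multiplied by a continuous positive
function. The Riemannian volume and all its constant multiples are of this form.
The normalisation `m univ = 1` is imposed separately, by `IsProbabilityMeasure m`. -/
def IsVolumeMeasure {d : ℕ} {M : Type*} [TopologicalSpace M] [MeasurableSpace M]
    [ChartedSpace (EuclideanSpace ℝ (Fin d)) M] (m : Measure M) : Prop :=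
  ∀ p : M, ∃ ρ : EuclideanSpace ℝ (Fin d) → ℝ,
    ContinuousOn ρ (chartAt (EuclideanSpace ℝ (Fin d)) p).target ∧
    (∀ y ∈ (chartAt (EuclideanSpace ℝ (Fin d)) p).target, 0 < ρ y) ∧
    (m.restrict (chartAt (EuclideanSpace ℝ (Fin d)) p).source).map
        (chartAt (EuclideanSpace ℝ (Fin d)) p) =
      (volume.restrict (chartAt (EuclideanSpace ℝ (Fin d)) p).target).withDensity
        (fun y => ENNReal.ofReal (ρ y))

/-! ### The unperturbed map -/

/-- `f` is continuous on a set `Y` of full measure that contains a dense forward orbit. -/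
structure IsTransitiveOn {M : Type*} [TopologicalSpace M] [MeasurableSpace M]
    (Leb : Measure M) (f : M → M) (Y : Set M) (x₀ : M) : Prop where
  full : ∀ᵐ x ∂Leb, x ∈ Y
  cont : ContinuousOn f Y
  orbit_mem : ∀ n : ℕ, f^[n] x₀ ∈ Y
  orbit_dense : Dense (Set.range fun n : ℕ => f^[n] x₀)

/-! ### Random perturbations -/

/-- The family `f_ω = F · ω`, `ω ∈ X`, with noise distribution `θ`, is a uniformly continuous
random perturbation of `f`. Here `f^x = F x : X → M` and `θ.map (F x)` is the law `(f^x)_* θ` of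
the perturbed image of `x`. The perturbed images are required to cover the ball of radius `ρ₀`
around `f x` in the sense that this ball lies in the support of `(f^x)_* θ`; for `f^x` continuous
this support contains `f^x (supp θ)`, see `image_support_subset`. -/
structure IsUniformRandomPerturbation {M X : Type*} [MetricSpace M] [MeasurableSpace M]
    [MetricSpace X] [MeasurableSpace X]
    (Leb : Measure M) (f : M → M) (F : M → X → M) (θ : Measure X) (ωstar : X) : Prop where
  measurable : Measurable (Function.uncurry F)
  support : ∃ ε₀ > 0, Metric.ball ωstar ε₀ ⊆ θ.support
  unperturbed : ∀ x, F x ωstar = f x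
  covers : ∃ ρ₀ > 0, ∀ᵐ x ∂Leb, Metric.ball (f x) ρ₀ ⊆ (θ.map (F x)).support
  density : ∃ qlo qhi : ℝ, 0 < qlo ∧ qlo < qhi ∧ ∀ᵐ x ∂Leb, ∃ q : M → ℝ≥0, Measurable q ∧
    θ.map (F x) = Leb.withDensity (fun y => (q y : ℝ≥0∞)) ∧
    ∀ᵐ y ∂Leb, y ∈ (θ.map (F x)).support → qlo ≤ q y ∧ (q y : ℝ) ≤ qhi

/-- For continuous `g`, the image of the support lies in the support of the image measure. -/
theorem image_support_subset {M X : Type*} [TopologicalSpace M] [MeasurableSpace M] [BorelSpace M]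
    [TopologicalSpace X] [MeasurableSpace X] [BorelSpace X] (θ : Measure X) {g : X → M}
    (hg : Continuous g) : g '' θ.support ⊆ (θ.map g).support := by
  rintro _ ⟨x, hx, rfl⟩
  rw [Measure.mem_support_iff_forall] at hx ⊢
  intro U hU
  exact (hx _ (hg.continuousAt hU)).trans_le (Measure.le_map_apply hg.aemeasurable U)

/-- The random orbit `f^n_ω x = f_{ω_n} ∘ ⋯ ∘ f_{ω_1} x`; the letters `ω_1, ω_2, …` of the
realisation are `ω 0, ω 1, …`. -/
def randomOrbit {M X : Type*} (F : M → X → M) (x : M) (ω : ℕ → X) : ℕ → M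
  | 0 => x
  | n + 1 => F (randomOrbit F x ω n) (ω n)

/-- `μ` is stationary for the random maps `f_ω`: `∬ g ∘ f_ω dμ dθ(ω) = ∫ g dμ`. -/
def IsStationary {M X : Type*} [MeasurableSpace M] [MeasurableSpace X]
    (F : M → X → M) (θ : Measure X) (μ : Measure M) : Prop :=
  ∀ g : M → ℝ, Integrable g μ → ∫ ω, (∫ x, g (F x ω) ∂μ) ∂θ = ∫ x, g x ∂μ

/-- The noise space `X^ℕ` carries the product measure `θ^ℕ`, and `M × X^ℕ` carries `μ × θ^ℕ`. -/
def annealedMeasure {M X : Type*} [MeasurableSpace M] [MeasurableSpace X]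
    (μ : Measure M) (θ : Measure X) : Measure (M × (ℕ → X)) :=
  μ.prod (Measure.infinitePi fun _ : ℕ => θ)

instance {M X : Type*} [MeasurableSpace M] [MeasurableSpace X]
    (μ : Measure M) (θ : Measure X) [IsProbabilityMeasure μ] [IsProbabilityMeasure θ] :
    IsProbabilityMeasure (annealedMeasure μ θ) := by
  unfold annealedMeasure; infer_instance

/-! ### Markov chains -/

/-- The transition probabilities `p_x = q_x Leb` have positive, Hölder continuous densities `q_x`
varying continuously with `x` in the uniform topology, with `supp q_x ⊇ B(f x, ρ₀)` and
`qlo ≤ q_x ≤ qhi` for `x ∈ Y`. -/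
structure IsMarkovPerturbation {M : Type*} [MetricSpace M] [MeasurableSpace M]
    (Leb : Measure M) (f : M → M) (Y : Set M) (p : Kernel M M) : Prop where
  density : ∃ q : C(M, C(M, ℝ)),
    (∀ x y, 0 < q x y) ∧
    (∀ x, p x = Leb.withDensity (fun y => ENNReal.ofReal (q x y))) ∧
    (∃ α : ℝ≥0, 0 < α ∧ ∀ x, ∃ C : ℝ≥0, HolderWith C α (q x)) ∧
    (∃ ρ₀ > 0, ∀ x ∈ Y, Metric.ball (f x) ρ₀ ⊆ tsupport (q x)) ∧
    ∃ qlo qhi : ℝ, 0 < qlo ∧ qlo < qhi ∧ ∀ x ∈ Y, ∀ y, qlo ≤ q x y ∧ q x y ≤ qhi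

/-- `Z₀, Z₁, …` is a Markov chain on `(Ω, P)` with transition probabilities `p` and initial
distribution `μ`. -/
structure IsMarkovChain {M Ω : Type*} [MeasurableSpace M] [MeasurableSpace Ω]
    (P : Measure Ω) (p : Kernel M M) (μ : Measure M) (Z : ℕ → Ω → M) : Prop where
  measurable : ∀ n, Measurable (Z n)
  initial : P.map (Z 0) = μ
  transition : ∀ (n : ℕ) (B : Set (Fin (n + 1) → M)) (A : Set M),
    MeasurableSet B → MeasurableSet A →
    P {ω | (fun i : Fin (n + 1) => Z i ω) ∈ B ∧ Z (n + 1) ω ∈ A} =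
      ∫⁻ ω in {ω | (fun i : Fin (n + 1) => Z i ω) ∈ B}, p (Z n ω) A ∂P

/-! ### The observable -/

/-- `φ` is measurable and has a global maximum at `ζ`; the superlevel sets `{φ > u}` are, for
`u < φ ζ` close to `φ ζ`, topological balls centred at `ζ`; and `μ {φ > u}` depends continuously
on `u` in a neighbourhood of `φ ζ`. -/
structure IsRegularObservable (d : ℕ) {M : Type*} [TopologicalSpace M] [MeasurableSpace M]
    (μ : Measure M) (φ : M → EReal) (ζ : M) : Prop where
  measurable : Measurable φ
  max : ∀ x, φ x ≤ φ ζ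
  ball : ∀ᶠ u in 𝓝[<] (φ ζ),
    ∃ h : Metric.ball (0 : EuclideanSpace ℝ (Fin d)) 1 ≃ₜ {x : M | u < φ x},
      (h ⟨0, Metric.mem_ball_self one_pos⟩ : M) = ζ
  cont : ∃ V ∈ 𝓝 (φ ζ), ContinuousOn (fun u : EReal => μ {x | u < φ x}) V

/-! ### Exceedances and the conditions on the process -/

/-- The ring generated by the intervals `[a, b)`, `a, b ∈ [0, ∞)`: finite unions of them. -/
def InRing (A : Set ℝ) : Prop :=
  ∃ s : Finset (ℝ × ℝ), (∀ I ∈ s, 0 ≤ I.1 ∧ 0 ≤ I.2) ∧ A = ⋃ I ∈ s, Set.Ico I.1 I.2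

/-- The number `∑_{i ∈ A ∩ ℕ₀} 1_{X_i > u}` of exceedances of the level `u` at times in `A`. -/
def exceedances {Ω : Type*} (X : ℕ → Ω → EReal) (u : ℝ) (A : Set ℝ) (ω : Ω) : ℝ≥0∞ :=
  ∑' i : ℕ, Set.indicator {i : ℕ | (i : ℝ) ∈ A ∧ (u : EReal) < X i ω} 1 i

/-- The rare event point process `N_n(J)`: the number of exceedances of `u_n` during `v_n J`, with
`v_n = 1 / P(X₀ > u_n)`. -/
def repp {Ω : Type*} [MeasurableSpace Ω] (P : Measure Ω) (X : ℕ → Ω → EReal) (u : ℕ → ℝ)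
    (n : ℕ) (J : Set ℝ) (ω : Ω) : ℝ≥0∞ :=
  exceedances X (u n) ((fun s => (P.real {ω | (u n : EReal) < X 0 ω})⁻¹ * s) '' J) ω

/-- Condition `D₃(u_n)`, with `t` in the role of the sequence `t_n = o(n)`. -/
def CondD3 {Ω : Type*} [MeasurableSpace Ω] (P : Measure Ω) (X : ℕ → Ω → EReal) (u : ℕ → ℝ)
    (t : ℕ → ℕ) : Prop :=
  Tendsto (fun n : ℕ => (t n : ℝ) / n) atTop (𝓝 0) ∧
  ∃ γ : ℕ → ℕ → ℝ,
    (∀ A : Set ℝ, InRing A → ∀ n s : ℕ,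
      |P.real {ω | (u n : EReal) < X 0 ω ∧
          exceedances X (u n) ((fun r => r + (s : ℝ)) '' A) ω = 0}
        - P.real {ω | (u n : EReal) < X 0 ω} * P.real {ω | exceedances X (u n) A ω = 0}|
        ≤ γ n s) ∧
    (∀ n, Antitone (γ n)) ∧
    Tendsto (fun n : ℕ => (n : ℝ) * γ n (t n)) atTop (𝓝 0)

/-- Condition `D'(u_n)`, relative to the sequence `t_n`: there are integers `k_n → ∞` with
`k_n t_n = o(n)` and `n ∑_{j=1}^{⌊n/k_n⌋} P(X₀ > u_n, X_j > u_n) → 0`. -/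
def CondD' {Ω : Type*} [MeasurableSpace Ω] (P : Measure Ω) (X : ℕ → Ω → EReal) (u : ℕ → ℝ)
    (t : ℕ → ℕ) : Prop :=
  ∃ k : ℕ → ℕ, Tendsto k atTop atTop ∧
    Tendsto (fun n : ℕ => (k n : ℝ) * t n / n) atTop (𝓝 0) ∧
    Tendsto (fun n : ℕ => (n : ℝ) * ∑ j ∈ Finset.Icc 1 (n / k n),
      P.real {ω | (u n : EReal) < X 0 ω ∧ (u n : EReal) < X j ω}) atTop (𝓝 0)

/-! ### The Poisson process -/

/-- `N` is a Poisson process of intensity `1` on `[0, ∞)`: a random measure that gives every Borel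
set `B ⊆ [0, ∞)` of finite length a Poisson distributed mass with mean the length of `B`, and gives
disjoint sets independent masses. -/
structure IsPoissonProcess {Ω : Type*} [MeasurableSpace Ω] (Q : Measure Ω)
    (N : Ω → Measure ℝ) : Prop where
  measurable : Measurable N
  law : ∀ B : Set ℝ, MeasurableSet B → B ⊆ Set.Ici 0 → volume B ≠ ∞ →
    Q.map (fun ω => N ω B) =
      (poissonMeasure (volume B).toNNReal).map (fun n : ℕ => (n : ℝ≥0∞))
  indep : ∀ (k : ℕ) (B : Fin k → Set ℝ), (∀ i, MeasurableSet (B i)) → (∀ i, B i ⊆ Set.Ici 0) →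
    Pairwise (fun i j => Disjoint (B i) (B j)) → iIndepFun (fun i ω => N ω (B i)) Q

/-- Convergence in distribution of the point processes `N_n` to `N`: for all `J₁, …, J_k` in the
ring, the random vectors `(N_n(J₁), …, N_n(J_k))` converge in distribution to
`(N(J₁), …, N(J_k))`. -/
def ConvergesInDistribution {Ω Ω' : Type*} [MeasurableSpace Ω] [MeasurableSpace Ω']
    (P : Measure Ω) [IsProbabilityMeasure P] (Nn : ℕ → Set ℝ → Ω → ℝ≥0∞)
    (Q : Measure Ω') [IsProbabilityMeasure Q] (N : Ω' → Measure ℝ) : Prop :=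
  ∀ (k : ℕ) (J : Fin k → Set ℝ), (∀ i, InRing (J i)) →
    TendstoInDistribution (fun (n : ℕ) (ω : Ω) (i : Fin k) => Nn n (J i) ω) atTop
      (fun (ω : Ω') (i : Fin k) => N ω (J i)) (fun _ => P) Q

/-- The process `X` satisfies `D₃(u_n)` and `D'(u_n)` (the latter relative to every sequence
`t_n = o(n)` that is admissible in `D₃(u_n)`), and its rare event point processes converge in
distribution to the Poisson process of intensity `1`. -/
def HasPoissonRareEvents.{v, w} {Ω : Type w} [MeasurableSpace Ω] (P : Measure Ω)
    [IsProbabilityMeasure P] (X : ℕ → Ω → EReal) (u : ℕ → ℝ) : Prop :=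
  (∃ t : ℕ → ℕ, CondD3 P X u t) ∧
  (∀ t : ℕ → ℕ, CondD3 P X u t → CondD' P X u t) ∧
  ∀ (Ω' : Type v) [MeasurableSpace Ω'] (Q : Measure Ω') [IsProbabilityMeasure Q]
    (N : Ω' → Measure ℝ), IsPoissonProcess Q N →
    ConvergesInDistribution P (repp P X u) Q N

end RareEvents

end

open RareEvents
universe a b c v

/-!
Write `δ = μ {φ > u n}`, so that `n δ → τ`. In both families of perturbations some power `p ^ N` of
the transition kernel dominates a multiple of `μ` (Doeblin's condition), while `p x ≤ C • μ`. For
random maps this needs an argument: one step dominates a multiple of `Leb` on the ball `B (f x) ρ`,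
so `k` steps dominate a multiple of `Leb` on every ball that pseudo-orbits of `f` reach in `k`
steps. The dense orbit provides pseudo-orbits between any two places, and their lengths have no
common period `g > 1`, since the residue of the length modulo `g` would be locally constant on the
connected space `M`. Hence, for some `N`, pseudo-orbits of length `N` lead from everywhere to
everywhere.

Doeblin's condition makes `∫ g d(p ^ t) x` converge to `∫ g dμ` exponentially fast, uniformly in
`x`, which together with the Markov property gives `D₃`. The upper bound on `p x` makes the
probability of two exceedances at given times `O(δ ^ 2)`, which gives `D'`.

For the point processes let `0 ≤ w i ≤ 1` and let `Q m` be the product of `1 - w i` over the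
exceedance times `i < m`. Forgetting a gap of length `t` with `δ ≪ t δ ≪ 1` decorrelates `Q m` from
the exceedance at time `m`, whence `E Q (m + 1) ≈ (1 - w m * δ) * E Q m` with an error `o(δ)`. For
`w i = W (i δ)`, where `W = 1 - exp (-∑ j, a j * 1_(J j))`, summing over the `O(1 / δ)` steps yields
`exp (-∫ W)`, the joint Laplace transform of the Poisson process on the `J j`.
-/

namespace RareEvents

/-! ### Bounded measurable functions and averages along a kernel -/

/-- `g` is bounded and measurable. These are the test functions of the Markov property: they are
stable under products and under averaging along a kernel, and always integrable. -/
def BddMeas {α : Type*} [MeasurableSpace α] (g : α → ℝ) : Prop :=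
  Measurable g ∧ ∃ K, ∀ x, |g x| ≤ K

section BddMeas

variable {α β : Type*} [MeasurableSpace α] [MeasurableSpace β] {g h : α → ℝ}

namespace BddMeas

theorem integrable (hg : BddMeas g) (ν : Measure α) [IsFiniteMeasure ν] : Integrable g ν :=
  let ⟨hm, K, hK⟩ := hg
  Integrable.of_bound hm.aestronglyMeasurable K (ae_of_all _ hK)

theorem const (a : ℝ) : BddMeas fun _ : α => a := ⟨measurable_const, |a|, fun _ => le_rfl⟩

theorem sub (hg : BddMeas g) (hh : BddMeas h) : BddMeas fun x => g x - h x := by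
  obtain ⟨hg, K, hK⟩ := hg
  obtain ⟨hh, L, hL⟩ := hh
  exact ⟨hg.sub hh, K + L, fun x => (abs_sub _ _).trans (add_le_add (hK x) (hL x))⟩

theorem mul (hg : BddMeas g) (hh : BddMeas h) : BddMeas fun x => g x * h x := by
  obtain ⟨hg, K, hK⟩ := hg
  obtain ⟨hh, L, hL⟩ := hh
  refine ⟨hg.mul hh, K * L, fun x => ?_⟩
  rw [abs_mul]
  exact mul_le_mul (hK x) (hL x) (abs_nonneg _) ((abs_nonneg _).trans (hK x))

theorem comp (hg : BddMeas g) {f : β → α} (hf : Measurable f) : BddMeas fun x => g (f x) :=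
  ⟨hg.1.comp hf, hg.2.imp fun _ hK x => hK (f x)⟩

theorem indicator_one {s : Set α} (hs : MeasurableSet s) :
    BddMeas (s.indicator (1 : α → ℝ)) := by
  refine ⟨measurable_one.indicator hs, 1, fun x => ?_⟩
  by_cases hx : x ∈ s <;> simp [hx]

end BddMeas

end BddMeas

section Kernel

variable {M : Type*} [MeasurableSpace M] {p κ η : Kernel M M} {μ ν : Measure M} {g : M → ℝ}

instance isMarkovKernel_pow [IsMarkovKernel p] (n : ℕ) : IsMarkovKernel (p ^ n) := by
  induction n with
  | zero => exact inferInstanceAs (IsMarkovKernel Kernel.id)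
  | succ n ih => exact inferInstanceAs (IsMarkovKernel ((p ^ n) ∘ₖ p))

theorem invariant_pow (hμ : p.Invariant μ) (n : ℕ) : (p ^ n).Invariant μ := by
  induction n with
  | zero => exact Measure.id_comp
  | succ n ih => exact ih.comp hμ

/-- The Markov operator `g ↦ ∫ g dp_x` of the kernel `p`. -/
noncomputable def avg (p : Kernel M M) (g : M → ℝ) (x : M) : ℝ := ∫ y, g y ∂p x

theorem abs_avg_le [IsMarkovKernel p] {b : ℝ} {x : M} (hb : ∀ᵐ y ∂p x, |g y| ≤ b) :
    |avg p g x| ≤ b := by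
  simpa [avg] using norm_integral_le_of_norm_le_const (f := g) hb

theorem BddMeas.avg [IsMarkovKernel p] (hg : BddMeas g) : BddMeas (avg p g) :=
  ⟨hg.1.stronglyMeasurable.integral_kernel.measurable,
    hg.2.imp fun _ hK _ => abs_avg_le (ae_of_all _ hK)⟩

theorem avg_one (hg : BddMeas g) : avg (1 : Kernel M M) g = g :=
  funext fun x => integral_dirac' g x hg.1.stronglyMeasurable

theorem avg_mul [IsMarkovKernel κ] [IsMarkovKernel η] (hg : BddMeas g) :
    avg (η * κ) g = avg κ (avg η g) :=
  funext fun x => ProbabilityTheory.Kernel.integral_comp (a := x) (hg.integrable ((η ∘ₖ κ) x))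

theorem avg_sub_const [IsMarkovKernel p] (hg : BddMeas g) (a : ℝ) (x : M) :
    avg p (fun y => g y - a) x = avg p g x - a := by
  simp [avg, integral_sub (hg.integrable _)]

theorem avg_indicator_one {U : Set M} (hU : MeasurableSet U) (x : M) :
    avg p (U.indicator 1) x = (p x).real U := integral_indicator_one hU

theorem integral_avg [IsMarkovKernel p] [IsProbabilityMeasure μ] (hμ : p.Invariant μ)
    (hg : BddMeas g) : ∫ x, avg p g x ∂μ = ∫ x, g x ∂μ := by
  have h := hg.integrable (p ∘ₘ μ)
  rw [Measure.comp_eq_comp_const_apply] at h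
  conv_rhs => rw [← hμ.def, Measure.comp_eq_comp_const_apply, Kernel.integral_comp h]
  rfl

theorem ae_ae_of_invariant (hμ : p.Invariant μ) {s : M → Prop} (hs : ∀ᵐ x ∂μ, s x) :
    ∀ᵐ x ∂μ, ∀ᵐ y ∂p x, s y :=
  Measure.ae_ae_of_ae_comp (by rwa [hμ.def])

/-- Only the part of `ν` not accounted for by `c • μ` contributes, and its mass is `1 - c`. -/
theorem abs_integral_le_of_smul_le [IsProbabilityMeasure μ] [IsProbabilityMeasure ν] {c : ℝ≥0}
    (h : c • μ ≤ ν) (hg : BddMeas g) {b : ℝ} (hb : ∀ᵐ x ∂ν, |g x| ≤ b)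
    (h0 : ∫ x, g x ∂μ = 0) : |∫ x, g x ∂ν| ≤ (1 - c) * b := by
  have hsplit : ν - c • μ + c • μ = ν := Measure.sub_add_cancel_of_le h
  have hmass : (ν - c • μ).real univ = 1 - c := by
    have : (ν - c • μ).real univ + (c • μ).real univ = 1 := by
      rw [← measureReal_add_apply, hsplit, probReal_univ]
    simpa [measureReal_nnreal_smul_apply, ← eq_sub_iff_add_eq] using this
  have hint : ∫ x, g x ∂ν = ∫ x, g x ∂(ν - c • μ) := by
    conv_lhs => rw [← hsplit, integral_add_measure (hg.integrable _) (hg.integrable _)]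
    rw [integral_smul_nnreal_measure, h0, smul_zero, add_zero]
  rw [hint, mul_comm, ← hmass]
  exact norm_integral_le_of_norm_le_const (f := g) (hb.filter_mono (ae_mono Measure.sub_le))

/-- The Doeblin setting: `μ` is a stationary measure of `p`, the `N`-step kernel dominates `c • μ`,
and the kernel itself has density at most `C` with respect to `μ`. -/
structure IsDoeblinKernel (p : Kernel M M) (μ : Measure M) (N : ℕ) (c C : ℝ≥0) : Prop where
  invariant : p.Invariant μ
  minorization : ∀ᵐ x ∂μ, c • μ ≤ (p ^ N) x
  bound : ∀ᵐ x ∂μ, p x ≤ C • μ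
  N_pos : 0 < N
  c_pos : 0 < c

namespace IsDoeblinKernel

variable [IsMarkovKernel p] [IsProbabilityMeasure μ] {N : ℕ} {c C : ℝ≥0}
  (hp : IsDoeblinKernel p μ N c C)

include hp

theorem c_le_one : (c : ℝ) ≤ 1 := by
  obtain ⟨x, hx⟩ := hp.minorization.exists
  simpa using hx univ

theorem one_le_C : (1 : ℝ) ≤ C := by
  obtain ⟨x, hx⟩ := hp.bound.exists
  simpa using hx univ

theorem rate_nonneg : 0 ≤ 1 - (c : ℝ) := sub_nonneg.2 hp.c_le_one

theorem tendsto_rate : Tendsto (fun t : ℕ => (1 - (c : ℝ)) ^ (t / N)) atTop (𝓝 0) :=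
  (tendsto_pow_atTop_nhds_zero_of_lt_one hp.rate_nonneg
    (sub_lt_self 1 (NNReal.coe_pos.2 hp.c_pos))).comp (Nat.tendsto_div_const_atTop hp.N_pos.ne')

theorem antitone_rate : Antitone fun t : ℕ => (1 - (c : ℝ)) ^ (t / N) := fun _ _ hst =>
  pow_le_pow_of_le_one hp.rate_nonneg (sub_le_self 1 c.coe_nonneg) (Nat.div_le_div_right hst)

theorem abs_avg_pow_mul_le (hg : BddMeas g) {b : ℝ} (hb : ∀ᵐ x ∂μ, |g x| ≤ b)
    (h0 : ∫ x, g x ∂μ = 0) (k : ℕ) :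
    ∀ᵐ x ∂μ, |avg (p ^ (N * k)) g x| ≤ (1 - (c : ℝ)) ^ k * b := by
  induction k with
  | zero => simpa [avg_one hg] using hb
  | succ k ih =>
    have hmean : ∫ x, avg (p ^ (N * k)) g x ∂μ = 0 := by
      rw [integral_avg (invariant_pow hp.invariant _) hg, h0]
    filter_upwards [hp.minorization, ae_ae_of_invariant (invariant_pow hp.invariant N) ih]
      with x hx hbx
    rw [mul_add_one, pow_add, avg_mul hg, pow_succ', mul_assoc]
    exact abs_integral_le_of_smul_le hx hg.avg hbx hmean

theorem abs_avg_pow_le (hg : BddMeas g) {b : ℝ} (hb : ∀ᵐ x ∂μ, |g x| ≤ b)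
    (h0 : ∫ x, g x ∂μ = 0) (t : ℕ) :
    ∀ᵐ x ∂μ, |avg (p ^ t) g x| ≤ (1 - (c : ℝ)) ^ (t / N) * b := by
  filter_upwards [ae_ae_of_invariant (invariant_pow hp.invariant (t % N))
    (hp.abs_avg_pow_mul_le hg hb h0 (t / N))] with x hx
  rw [← Nat.div_add_mod t N, pow_add, avg_mul hg, Nat.div_add_mod]
  exact abs_avg_le hx

theorem abs_avg_pow_sub_le (hg : BddMeas g) {b : ℝ} (hb : ∀ᵐ x ∂μ, |g x - ∫ y, g y ∂μ| ≤ b)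
    (t : ℕ) : ∀ᵐ x ∂μ, |avg (p ^ t) g x - ∫ y, g y ∂μ| ≤ (1 - (c : ℝ)) ^ (t / N) * b := by
  have h0 : ∫ x, (g x - ∫ y, g y ∂μ) ∂μ = 0 := by
    simp [integral_sub (hg.integrable _)]
  simpa only [avg_sub_const hg] using hp.abs_avg_pow_le (hg.sub (.const _)) hb h0 t

omit [IsMarkovKernel p] in
theorem real_le {U : Set M} : ∀ᵐ x ∂μ, (p x).real U ≤ C * μ.real U := by
  filter_upwards [hp.bound] with x hx
  simpa [measureReal_def] using ENNReal.toReal_mono (by finiteness) (hx U)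

theorem abs_real_sub_le {U : Set M} : ∀ᵐ x ∂μ, |(p x).real U - μ.real U| ≤ C * μ.real U := by
  filter_upwards [hp.real_le (U := U)] with x hx
  have h1 : μ.real U ≤ C * μ.real U := le_mul_of_one_le_left measureReal_nonneg hp.one_le_C
  have h2 : 0 ≤ (p x).real U := measureReal_nonneg
  have h3 : 0 ≤ μ.real U := measureReal_nonneg
  exact abs_le.2 ⟨by linarith, by linarith⟩

end IsDoeblinKernel

end Kernel

/-! ### The Markov property -/

section IsPast

variable {M Ω : Type*} [MeasurableSpace M] {Z : ℕ → Ω → M}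

/-- `H` is a bounded measurable function of `Z 0, …, Z m`. The function `H` is exhibited on the
space of initial segments, so that it can be integrated against their law. -/
def IsPast (Z : ℕ → Ω → M) (m : ℕ) (H : Ω → ℝ) : Prop :=
  ∃ H' : (Fin (m + 1) → M) → ℝ, BddMeas H' ∧ H = fun ω => H' fun i => Z i ω

namespace IsPast

variable {m : ℕ} {H K : Ω → ℝ}

theorem bddMeas [MeasurableSpace Ω] (hH : IsPast Z m H) (hZ : ∀ n, Measurable (Z n)) :
    BddMeas H := by
  obtain ⟨H', hH', rfl⟩ := hH
  exact hH'.comp (measurable_pi_lambda _ fun i => hZ i)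

theorem mono (hH : IsPast Z m H) {n : ℕ} (hmn : m ≤ n) : IsPast Z n H := by
  obtain ⟨H', hH', rfl⟩ := hH
  exact ⟨fun v => H' fun i => v (Fin.castLE (by omega) i),
    hH'.comp (measurable_pi_lambda _ fun i => measurable_pi_apply _), rfl⟩

theorem const (a : ℝ) : IsPast Z m fun _ => a := ⟨fun _ => a, .const a, rfl⟩

theorem apply {h : M → ℝ} (hh : BddMeas h) {i : ℕ} (hi : i ≤ m) :
    IsPast Z m fun ω => h (Z i ω) :=
  ⟨fun v => h (v ⟨i, by omega⟩), hh.comp (measurable_pi_apply _), rfl⟩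

theorem mul (hH : IsPast Z m H) (hK : IsPast Z m K) : IsPast Z m fun ω => H ω * K ω := by
  obtain ⟨H', hH', rfl⟩ := hH
  obtain ⟨K', hK', rfl⟩ := hK
  exact ⟨_, hH'.mul hK', rfl⟩

theorem prod_range {h : ℕ → M → ℝ} (hh : ∀ i, BddMeas (h i)) {n : ℕ} (hn : n ≤ m + 1) :
    IsPast Z m fun ω => ∏ i ∈ Finset.range n, h i (Z i ω) := by
  induction n with
  | zero => simpa using const 1
  | succ n ih =>
    simp only [Finset.prod_range_succ]
    exact (ih (by omega)).mul (apply (hh n) (by omega))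

end IsPast

end IsPast

section expectedProd

variable {M : Type*} [MeasurableSpace M] {p : Kernel M M} [IsMarkovKernel p] {h : ℕ → M → ℝ}

/-- The expectation of `∏ i < L, h i (Z i)` for the Markov chain `Z` with transition
probabilities `p` started at the last argument. -/
noncomputable def expectedProd (p : Kernel M M) : ℕ → (ℕ → M → ℝ) → M → ℝ
  | 0, _ => fun _ => 1
  | L + 1, h => fun x => h 0 x * avg p (expectedProd p L fun i => h (i + 1)) x

theorem bddMeas_expectedProd (hh : ∀ i, BddMeas (h i)) (L : ℕ) :
    BddMeas (expectedProd p L h) := by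
  induction L generalizing h with
  | zero => exact .const 1
  | succ L ih => exact (hh 0).mul (ih fun i => hh (i + 1)).avg

theorem expectedProd_mem_Icc (h01 : ∀ i x, h i x ∈ Icc (0 : ℝ) 1) (L : ℕ) (x : M) :
    expectedProd p L h x ∈ Icc (0 : ℝ) 1 := by
  induction L generalizing h x with
  | zero => simp [expectedProd]
  | succ L ih =>
    have hΦ := ih fun i => h01 (i + 1)
    have hle := abs_avg_le (p := p) (x := x)
      (ae_of_all _ fun y => (abs_of_nonneg (hΦ y).1).trans_le (hΦ y).2)
    exact unitInterval.mul_mem (h01 0 x)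
      ⟨integral_nonneg fun y => (hΦ y).1, le_of_abs_le hle⟩

end expectedProd

namespace IsMarkovChain

variable {M Ω : Type*} [MeasurableSpace M] [MeasurableSpace Ω] {P : Measure Ω}
  {p : Kernel M M} {μ : Measure M} {Z : ℕ → Ω → M} (hZ : IsMarkovChain P p μ Z)

include hZ

theorem map_eq (hμ : p.Invariant μ) (n : ℕ) : P.map (Z n) = μ := by
  induction n with
  | zero => exact hZ.initial
  | succ n ih =>
    ext A hA
    have h : P {ω | Z (n + 1) ω ∈ A} = ∫⁻ ω, p (Z n ω) A ∂P := by
      simpa using hZ.transition n univ A .univ hA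
    rw [Measure.map_apply (hZ.measurable _) hA]
    refine h.trans ?_
    rw [← lintegral_map (p.measurable_coe hA) (hZ.measurable n), ih,
      ← Measure.bind_apply hA p.aemeasurable, hμ.def]

theorem ae_apply (hμ : p.Invariant μ) {s : M → Prop} (hs : ∀ᵐ x ∂μ, s x) (n : ℕ) :
    ∀ᵐ ω ∂P, s (Z n ω) :=
  ae_of_ae_map (hZ.measurable n).aemeasurable (by rwa [hZ.map_eq hμ n])

theorem integral_apply (hμ : p.Invariant μ) {g : M → ℝ} (hg : BddMeas g) (n : ℕ) :
    ∫ ω, g (Z n ω) ∂P = ∫ x, g x ∂μ := by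
  rw [← hZ.map_eq hμ n, integral_map (hZ.measurable n).aemeasurable hg.1.aestronglyMeasurable]

theorem real_apply_mem (hμ : p.Invariant μ) {U : Set M} (hU : MeasurableSet U) (n : ℕ) :
    P.real {ω | Z n ω ∈ U} = μ.real U := by
  rw [← hZ.map_eq hμ n, map_measureReal_apply (hZ.measurable n) hU]
  rfl

variable [IsProbabilityMeasure P] [IsMarkovKernel p]

theorem map_prodMk_succ (n : ℕ) :
    P.map (fun ω => ((fun i : Fin (n + 1) => Z i ω), Z (n + 1) ω)) =
      (P.map fun ω (i : Fin (n + 1)) => Z i ω) ⊗ₘ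
        p.comap (fun v : Fin (n + 1) → M => v (Fin.last n)) (measurable_pi_apply _) := by
  have hm : Measurable fun ω (i : Fin (n + 1)) => Z i ω :=
    measurable_pi_lambda _ fun i => hZ.measurable i
  refine Measure.ext_prod fun {B A} hB hA => ?_
  rw [Measure.map_apply (hm.prodMk (hZ.measurable _)) (hB.prod hA),
    Measure.compProd_apply_prod hB hA, setLIntegral_map hB (Kernel.measurable_coe _ hA) hm]
  exact hZ.transition n B A hB hA

theorem integral_mul_apply_succ {m : ℕ} {H : Ω → ℝ} (hH : IsPast Z m H) {g : M → ℝ}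
    (hg : BddMeas g) :
    ∫ ω, H ω * g (Z (m + 1) ω) ∂P = ∫ ω, H ω * avg p g (Z m ω) ∂P := by
  obtain ⟨H', hH', rfl⟩ := hH
  have hm : Measurable fun ω (i : Fin (m + 1)) => Z i ω :=
    measurable_pi_lambda _ fun i => hZ.measurable i
  have hHg : BddMeas fun q : (Fin (m + 1) → M) × M => H' q.1 * g q.2 :=
    (hH'.comp measurable_fst).mul (hg.comp measurable_snd)
  have hHavg : BddMeas fun v : Fin (m + 1) → M => H' v * avg p g (v (Fin.last m)) :=
    hH'.mul (hg.avg.comp (measurable_pi_apply _))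
  calc ∫ ω, H' (fun i => Z i ω) * g (Z (m + 1) ω) ∂P
      = ∫ q, H' q.1 * g q.2 ∂P.map fun ω => ((fun i : Fin (m + 1) => Z i ω), Z (m + 1) ω) :=
        (integral_map (hm.prodMk (hZ.measurable _)).aemeasurable
          hHg.1.aestronglyMeasurable).symm
    _ = ∫ v, H' v * avg p g (v (Fin.last m)) ∂P.map fun ω (i : Fin (m + 1)) => Z i ω := by
        rw [hZ.map_prodMk_succ, Measure.integral_compProd (hHg.integrable _)]
        simp only [integral_const_mul, Kernel.comap_apply, avg]
    _ = ∫ ω, H' (fun i => Z i ω) * avg p g (Z m ω) ∂P :=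
        integral_map hm.aemeasurable hHavg.1.aestronglyMeasurable

theorem integral_mul_apply_add {m : ℕ} {H : Ω → ℝ} (hH : IsPast Z m H) {g : M → ℝ}
    (hg : BddMeas g) (t : ℕ) :
    ∫ ω, H ω * g (Z (m + t) ω) ∂P = ∫ ω, H ω * avg (p ^ t) g (Z m ω) ∂P := by
  induction t generalizing g with
  | zero => simp [avg_one hg]
  | succ t ih =>
    rw [← add_assoc, hZ.integral_mul_apply_succ (hH.mono (by omega)) hg, ih hg.avg, pow_succ',
      avg_mul hg]

theorem integral_mul_prod {h : ℕ → M → ℝ} (hh : ∀ i, BddMeas (h i)) (L : ℕ) {s : ℕ} {H : Ω → ℝ}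
    (hH : IsPast Z s H) :
    ∫ ω, H ω * ∏ i ∈ Finset.range L, h i (Z (i + s) ω) ∂P =
      ∫ ω, H ω * expectedProd p L h (Z s ω) ∂P := by
  induction L generalizing h s H with
  | zero => simp [expectedProd]
  | succ L ih =>
    have hK : IsPast Z s fun ω => H ω * h 0 (Z s ω) := hH.mul (.apply (hh 0) le_rfl)
    calc ∫ ω, H ω * ∏ i ∈ Finset.range (L + 1), h i (Z (i + s) ω) ∂P
        = ∫ ω, H ω * h 0 (Z s ω) * ∏ i ∈ Finset.range L, h (i + 1) (Z (i + (s + 1)) ω) ∂P := by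
          congr 1 with ω
          rw [Finset.prod_range_succ', zero_add, mul_assoc, mul_comm (h 0 _)]
          simp only [add_right_comm _ 1 s, add_assoc]
      _ = ∫ ω, H ω * h 0 (Z s ω) * avg p (expectedProd p L fun i => h (i + 1)) (Z s ω) ∂P := by
          rw [ih (fun i => hh (i + 1)) (hK.mono (Nat.le_succ s)),
            hZ.integral_mul_apply_succ hK (bddMeas_expectedProd (fun i => hh (i + 1)) L)]
      _ = ∫ ω, H ω * expectedProd p (L + 1) h (Z s ω) ∂P := by simp only [mul_assoc, expectedProd]

variable [IsProbabilityMeasure μ] {N : ℕ} {c C : ℝ≥0} (hp : IsDoeblinKernel p μ N c C)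

include hp

theorem abs_integral_mul_sub_le {m : ℕ} {H : Ω → ℝ} (hH : IsPast Z m H) {g : M → ℝ}
    (hg : BddMeas g) {b : ℝ} (hb : ∀ᵐ x ∂μ, |g x - ∫ y, g y ∂μ| ≤ b) (t : ℕ) :
    |∫ ω, H ω * g (Z (m + t) ω) ∂P - (∫ ω, H ω ∂P) * ∫ x, g x ∂μ| ≤
      (∫ ω, |H ω| ∂P) * ((1 - c) ^ (t / N) * b) := by
  have hHb := hH.bddMeas hZ.measurable
  have hgt : BddMeas fun ω => avg (p ^ t) g (Z m ω) := hg.avg.comp (hZ.measurable m)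
  rw [hZ.integral_mul_apply_add hH hg, ← integral_mul_const,
    ← integral_sub ((hHb.mul hgt).integrable _) ((hHb.mul (.const _)).integrable _),
    ← integral_mul_const, ← Real.norm_eq_abs]
  refine norm_integral_le_of_norm_le ((hHb.integrable _).abs.mul_const _) ?_
  filter_upwards [hZ.ae_apply hp.invariant (hp.abs_avg_pow_sub_le hg hb t) m] with ω hω
  rw [← mul_sub, norm_mul, Real.norm_eq_abs, Real.norm_eq_abs]
  exact mul_le_mul_of_nonneg_left hω (abs_nonneg _)

variable {U : Set M} (hU : MeasurableSet U)

include hU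

theorem abs_integral_mul_indicator_sub_le {m : ℕ} {H : Ω → ℝ} (hH : IsPast Z m H)
    (h1 : ∀ ω, |H ω| ≤ 1) (t : ℕ) :
    |∫ ω, H ω * U.indicator 1 (Z (m + t + 1) ω) ∂P - (∫ ω, H ω ∂P) * μ.real U| ≤
      (1 - c) ^ (t / N) * (C * μ.real U) := by
  have hi : BddMeas (U.indicator (1 : M → ℝ)) := .indicator_one hU
  have hmean : ∫ x, avg p (U.indicator 1) x ∂μ = μ.real U := by
    rw [integral_avg hp.invariant hi, integral_indicator_one hU]
  have hosc : ∀ᵐ x ∂μ, |avg p (U.indicator 1) x - ∫ y, avg p (U.indicator 1) y ∂μ| ≤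
      C * μ.real U := by
    rw [hmean]
    simpa only [avg_indicator_one hU] using hp.abs_real_sub_le
  have hdecay := hZ.abs_integral_mul_sub_le hp hH hi.avg hosc t
  rw [hmean, ← hZ.integral_mul_apply_succ (hH.mono (Nat.le_add_right m t)) hi] at hdecay
  have hH1 : ∫ ω, |H ω| ∂P ≤ 1 := by
    simpa using integral_mono ((hH.bddMeas hZ.measurable).integrable P).abs
      (integrable_const 1) h1
  have hrate := hp.rate_nonneg
  exact hdecay.trans (mul_le_of_le_one_left (by positivity) hH1)

theorem integral_indicator_mul_indicator_le {i j : ℕ} (hij : i < j) :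
    ∫ ω, U.indicator 1 (Z i ω) * U.indicator 1 (Z j ω) ∂P ≤ C * μ.real U ^ 2 := by
  have hi : BddMeas (U.indicator (1 : M → ℝ)) := .indicator_one hU
  obtain ⟨j, rfl⟩ := Nat.exists_eq_succ_of_ne_zero (Nat.ne_zero_of_lt hij)
  have hbound : ∀ᵐ ω ∂P, avg p (U.indicator 1) (Z j ω) ≤ C * μ.real U := by
    simpa only [avg_indicator_one hU] using hZ.ae_apply hp.invariant hp.real_le j
  rw [Nat.succ_eq_add_one, hZ.integral_mul_apply_succ (.apply hi (Nat.le_of_lt_succ hij)) hi]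
  calc ∫ ω, U.indicator 1 (Z i ω) * avg p (U.indicator 1) (Z j ω) ∂P
      ≤ ∫ ω, U.indicator 1 (Z i ω) * (C * μ.real U) ∂P := by
        refine integral_mono_ae
          (((hi.comp (hZ.measurable i)).mul (hi.avg.comp (hZ.measurable j))).integrable _)
          (((hi.comp (hZ.measurable i)).mul (.const _)).integrable _) ?_
        filter_upwards [hbound] with ω hω
        exact mul_le_mul_of_nonneg_left hω (indicator_nonneg (fun _ _ => zero_le_one) _)
    _ = C * μ.real U ^ 2 := by
        rw [integral_mul_const, hZ.integral_apply hp.invariant hi, integral_indicator_one hU]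
        ring

theorem real_apply_mem_apply_mem_le {i j : ℕ} (hij : i < j) :
    P.real {ω | Z i ω ∈ U ∧ Z j ω ∈ U} ≤ C * μ.real U ^ 2 := by
  refine le_of_eq_of_le ?_ (hZ.integral_indicator_mul_indicator_le hp hU hij)
  refine (integral_indicator_one
    ((hZ.measurable i hU).inter (hZ.measurable j hU))).symm.trans ?_
  rw [inter_indicator_one]
  rfl

end IsMarkovChain

/-! ### The conditions `D₃` and `D'` -/

section exceedances

variable {Ω : Type*} {X : ℕ → Ω → EReal} {u : ℝ} {A : Set ℝ} {ω : Ω}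

theorem exceedances_eq_zero_iff :
    exceedances X u A ω = 0 ↔ ∀ i : ℕ, (i : ℝ) ∈ A → ¬ (u : EReal) < X i ω := by
  simp only [exceedances, ENNReal.tsum_eq_zero, indicator_apply_eq_zero, Set.mem_ofPred_eq,
    Pi.one_apply, one_ne_zero, imp_false, not_and]

theorem exceedances_image_add_eq_zero_iff (hA : ∀ x ∈ A, 0 ≤ x) {s : ℕ} :
    exceedances X u ((fun r => r + (s : ℝ)) '' A) ω = 0 ↔
      ∀ i : ℕ, (i : ℝ) ∈ A → ¬ (u : EReal) < X (i + s) ω := by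
  rw [exceedances_eq_zero_iff]
  refine ⟨fun h i hi => h (i + s) ⟨i, hi, by push_cast; rfl⟩, ?_⟩
  rintro h k ⟨r, hr, hrk⟩
  obtain ⟨i, rfl⟩ : ∃ i, k = i + s := by
    refine Nat.exists_eq_add_of_le' (Nat.cast_le (α := ℝ).1 ?_)
    exact hrk ▸ le_add_of_nonneg_left (hA r hr)
  refine h i ?_
  rwa [← (by simpa using hrk : r = i)]

theorem exceedances_eq_sum {L : ℕ} (hL : ∀ i : ℕ, (i : ℝ) ∈ A → i < L) :
    exceedances X u A ω =
      ∑ i ∈ Finset.range L, {i : ℕ | (i : ℝ) ∈ A ∧ (u : EReal) < X i ω}.indicator 1 i := by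
  refine tsum_eq_sum fun i hi => indicator_of_notMem (fun h => hi ?_) _
  exact Finset.mem_range.2 (hL i h.1)

theorem measurable_exceedances [MeasurableSpace Ω] (hX : ∀ n, Measurable (X n)) :
    Measurable (exceedances X u A) := by
  refine Measurable.tsum fun i => ?_
  exact measurable_one.indicator
    ((MeasurableSet.const ((i : ℝ) ∈ A)).inter (measurableSet_lt measurable_const (hX i)))

end exceedances

namespace InRing

variable {A : Set ℝ} (hA : InRing A)

include hA

theorem nonneg {x : ℝ} (hx : x ∈ A) : 0 ≤ x := by
  obtain ⟨s, hs, rfl⟩ := hA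
  simp only [mem_iUnion] at hx
  obtain ⟨I, hI, hx⟩ := hx
  exact (hs I hI).1.trans hx.1

theorem exists_lt : ∃ K : ℕ, ∀ x ∈ A, x < K := by
  obtain ⟨s, -, rfl⟩ := hA
  obtain ⟨b, hb⟩ : BddAbove (⋃ I ∈ s, Ico I.1 I.2) :=
    s.finite_toSet.bddAbove_biUnion.2 fun I _ => bddAbove_Ico
  obtain ⟨K, hK⟩ := exists_nat_gt b
  exact ⟨K, fun x hx => (hb hx).trans_lt hK⟩

end InRing

section visitProd

variable {M Ω : Type*} {U : Set M} {w : ℕ → ℝ} {z : ℕ → M}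

/-- The product of the factors `1 - w i` over the times `i < m` at which the trajectory `z` visits
`U`. For `w i ∈ {0, 1}` it is the indicator of having no visit at the times with `w i = 1`; for
`w i = 1 - exp (-s i)` it is the exponential of minus the sum of `s i` over the visits. -/
noncomputable def visitProd (U : Set M) (w : ℕ → ℝ) (m : ℕ) (z : ℕ → M) : ℝ :=
  ∏ i ∈ Finset.range m, (1 - w i * U.indicator 1 (z i))

theorem one_sub_mul_indicator_mem_Icc {a : ℝ} (ha : a ∈ Icc (0 : ℝ) 1) (x : M) :
    1 - a * U.indicator 1 x ∈ Icc (0 : ℝ) 1 := by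
  by_cases hx : x ∈ U <;> simp [hx, ha.1, ha.2]

theorem visitProd_succ (m : ℕ) :
    visitProd U w (m + 1) z =
      visitProd U w m z - w m * (visitProd U w m z * U.indicator 1 (z m)) := by
  rw [visitProd, Finset.prod_range_succ, ← visitProd]
  ring

theorem visitProd_mem_Icc (hw : ∀ i, w i ∈ Icc (0 : ℝ) 1) (m : ℕ) :
    visitProd U w m z ∈ Icc (0 : ℝ) 1 :=
  ⟨Finset.prod_nonneg fun i _ => (one_sub_mul_indicator_mem_Icc (hw i) _).1,
    Finset.prod_le_one (fun i _ => (one_sub_mul_indicator_mem_Icc (hw i) _).1)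
      fun i _ => (one_sub_mul_indicator_mem_Icc (hw i) _).2⟩

theorem visitProd_sub_visitProd_mem_Icc (hw : ∀ i, w i ∈ Icc (0 : ℝ) 1) {a m : ℕ} (ham : a ≤ m) :
    visitProd U w a z - visitProd U w m z ∈
      Icc (0 : ℝ) (∑ i ∈ Finset.Ico a m, U.indicator 1 (z i)) := by
  induction m, ham using Nat.le_induction with
  | base => simp
  | succ m ham ih =>
    have hQ := visitProd_mem_Icc (U := U) (z := z) hw m
    have hI : (0 : ℝ) ≤ U.indicator 1 (z m) := indicator_nonneg (fun _ _ => zero_le_one) _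
    have hQI : visitProd U w m z * U.indicator 1 (z m) ∈ Icc (0 : ℝ) (U.indicator 1 (z m)) :=
      ⟨mul_nonneg hQ.1 hI, mul_le_of_le_one_left hI hQ.2⟩
    have hlow := mul_nonneg (hw m).1 hQI.1
    have hupp := (mul_le_of_le_one_left hQI.1 (hw m).2).trans hQI.2
    rw [visitProd_succ, Finset.sum_Ico_succ_top ham]
    exact ⟨by linarith [ih.1], by linarith [ih.2]⟩

theorem visitProd_indicator_one (S : Set ℕ) [DecidablePred fun i => i ∈ S → z i ∉ U] (m : ℕ) :
    visitProd U (S.indicator 1) m z = if ∀ i ∈ Finset.range m, i ∈ S → z i ∉ U then 1 else 0 := by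
  trans ∏ i ∈ Finset.range m, if i ∈ S → z i ∉ U then (1 : ℝ) else 0
  swap
  · rw [Finset.prod_ite_zero, Finset.prod_const_one]
  refine Finset.prod_congr rfl fun i _ => ?_
  by_cases hS : i ∈ S <;> by_cases hz : z i ∈ U <;> simp [hS, hz]

theorem visitProd_eq_indicator_exceedances {φ : M → EReal} {u : ℝ} {A : Set ℝ} (hA : InRing A)
    {m : ℕ} (hm : ∀ x ∈ A, x < m) (Z : ℕ → Ω → M) (s : ℕ) (ω : Ω) :
    visitProd {x | (u : EReal) < φ x} ({i : ℕ | (i : ℝ) ∈ A}.indicator 1) m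
        (fun i => Z (i + s) ω) =
      {ω | exceedances (fun n ω => φ (Z n ω)) u ((fun r => r + (s : ℝ)) '' A) ω = 0}.indicator
        1 ω := by
  classical
  rw [visitProd_indicator_one, indicator_apply]
  refine if_congr ?_ rfl rfl
  rw [Set.mem_ofPred_eq, exceedances_image_add_eq_zero_iff fun x => hA.nonneg]
  exact ⟨fun h i hi => h i (Finset.mem_range.2 (Nat.cast_lt.1 (hm i hi))) hi,
    fun h i _ hi => h i hi⟩

variable [MeasurableSpace M] {Z : ℕ → Ω → M}

theorem bddMeas_one_sub_mul_indicator (hU : MeasurableSet U) (a : ℝ) :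
    BddMeas fun x => 1 - a * U.indicator 1 x :=
  .sub (.const 1) (.mul (.const a) (.indicator_one hU))

theorem isPast_visitProd (hU : MeasurableSet U) {n m : ℕ} (hn : n ≤ m + 1) :
    IsPast Z m fun ω => visitProd U w n fun i => Z i ω :=
  .prod_range (fun i => bddMeas_one_sub_mul_indicator hU (w i)) hn

end visitProd

theorem exists_tendsto_atTop_tendsto_mul_div {t : ℕ → ℕ}
    (ht : Tendsto (fun n => (t n : ℝ) / n) atTop (𝓝 0)) :
    ∃ k : ℕ → ℕ, Tendsto k atTop atTop ∧
      Tendsto (fun n => (k n : ℝ) * t n / n) atTop (𝓝 0) := by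
  set r : ℕ → ℝ := fun n => √((t n + 1) / n) with hr
  have hr_zero : Tendsto r atTop (𝓝 0) := by
    have h := ht.add tendsto_one_div_atTop_nhds_zero_nat
    simpa [hr, add_div] using h.sqrt
  have hr_pos : ∀ᶠ n in atTop, 0 < r n := by
    filter_upwards [eventually_gt_atTop 0] with n hn
    positivity
  refine ⟨fun n => ⌊(r n)⁻¹⌋₊, tendsto_nat_floor_atTop.comp (tendsto_inv_nhdsGT_zero.comp
    (tendsto_nhdsWithin_iff.2 ⟨hr_zero, hr_pos⟩)), ?_⟩
  refine squeeze_zero' (Eventually.of_forall fun n => by positivity) ?_ hr_zero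
  filter_upwards [hr_pos] with n hn
  calc (⌊(r n)⁻¹⌋₊ : ℝ) * t n / n = ⌊(r n)⁻¹⌋₊ * (t n / n) := mul_div_assoc _ _ _
    _ ≤ (r n)⁻¹ * ((t n + 1) / n) := by
        gcongr
        exacts [Nat.floor_le (by positivity), by linarith]
    _ = r n := by
        rw [← Real.mul_self_sqrt (show (0 : ℝ) ≤ (t n + 1) / n by positivity)]
        exact inv_mul_cancel_left₀ hn.ne' _

namespace IsMarkovChain

variable {M Ω : Type*} [MeasurableSpace M] [MeasurableSpace Ω] {P : Measure Ω}
  [IsProbabilityMeasure P] {p : Kernel M M} [IsMarkovKernel p] {μ : Measure M}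
  [IsProbabilityMeasure μ] {Z : ℕ → Ω → M} (hZ : IsMarkovChain P p μ Z)
  {N : ℕ} {c C : ℝ≥0} (hp : IsDoeblinKernel p μ N c C)

include hZ hp

theorem abs_integral_indicator_mul_visitProd_sub_le {U : Set M} (hU : MeasurableSet U) {w : ℕ → ℝ}
    (hw : ∀ i, w i ∈ Icc (0 : ℝ) 1) (m s : ℕ) :
    |∫ ω, U.indicator 1 (Z 0 ω) * visitProd U w m (fun i => Z (i + s) ω) ∂P -
        μ.real U * ∫ ω, visitProd U w m (fun i => Z i ω) ∂P| ≤
      μ.real U * (1 - c) ^ (s / N) := by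
  have hh := fun i => bddMeas_one_sub_mul_indicator hU (w i)
  set Φ := expectedProd p m fun i x => 1 - w i * U.indicator 1 x
  have hΦ : BddMeas Φ := bddMeas_expectedProd hh m
  have hΦ01 : ∀ x, Φ x ∈ Icc (0 : ℝ) 1 :=
    expectedProd_mem_Icc (fun i x => one_sub_mul_indicator_mem_Icc (hw i) x) m
  have hΦ_mean : ∫ x, Φ x ∂μ ∈ Icc (0 : ℝ) 1 :=
    (convex_Icc 0 1).integral_mem isClosed_Icc (ae_of_all _ hΦ01) (hΦ.integrable _)
  have hI : IsPast Z 0 fun ω => U.indicator (1 : M → ℝ) (Z 0 ω) :=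
    .apply (.indicator_one hU) le_rfl
  have hI_mean : ∫ ω, U.indicator (1 : M → ℝ) (Z 0 ω) ∂P = μ.real U := by
    rw [hZ.integral_apply hp.invariant (.indicator_one hU), integral_indicator_one hU]
  have hfuture := hZ.integral_mul_prod hh m (hI.mono (Nat.zero_le s))
  have hmean : ∫ ω, visitProd U w m (fun i => Z i ω) ∂P = ∫ x, Φ x ∂μ := by
    rw [← hZ.integral_apply hp.invariant hΦ 0]
    simpa only [one_mul] using! hZ.integral_mul_prod hh m (s := 0) (.const 1)
  have hdecay := hZ.abs_integral_mul_sub_le hp hI hΦ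
    (ae_of_all _ fun x => Real.dist_le_of_mem_Icc_01 (hΦ01 x) hΦ_mean) s
  have habs : ∀ ω, |U.indicator (1 : M → ℝ) (Z 0 ω)| = U.indicator 1 (Z 0 ω) :=
    fun ω => abs_of_nonneg (indicator_nonneg (fun _ _ => zero_le_one) _)
  simp only [habs] at hdecay
  rwa [zero_add, hI_mean, mul_one, ← hfuture, ← hmean] at hdecay

variable {φ : M → EReal} (hφ : Measurable φ)

include hφ

theorem abs_real_exceedances_sub_le (u : ℝ) {A : Set ℝ} (hA : InRing A) (s : ℕ) :
    |P.real {ω | (u : EReal) < φ (Z 0 ω) ∧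
          exceedances (fun n ω => φ (Z n ω)) u ((fun r => r + (s : ℝ)) '' A) ω = 0} -
        P.real {ω | (u : EReal) < φ (Z 0 ω)} *
          P.real {ω | exceedances (fun n ω => φ (Z n ω)) u A ω = 0}| ≤
      μ.real {x | (u : EReal) < φ x} * (1 - c) ^ (s / N) := by
  obtain ⟨m, hm⟩ := hA.exists_lt
  have hU : MeasurableSet {x | (u : EReal) < φ x} := measurableSet_lt measurable_const hφ
  have hE : ∀ B : Set ℝ, MeasurableSet {ω | exceedances (fun n ω => φ (Z n ω)) u B ω = 0} :=
    fun B => measurable_exceedances (fun n => hφ.comp (hZ.measurable n)) (measurableSet_singleton 0)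
  have hQ := visitProd_eq_indicator_exceedances (φ := φ) (u := u) hA hm Z
  have h0 : P.real {ω | (u : EReal) < φ (Z 0 ω)} = μ.real {x | (u : EReal) < φ x} :=
    hZ.real_apply_mem hp.invariant hU 0
  have hbound := hZ.abs_integral_indicator_mul_visitProd_sub_le hp hU
    (w := {i : ℕ | (i : ℝ) ∈ A}.indicator 1) (fun i => ?_) m s
  · simp only [hQ s] at hbound
    have hQ0 := fun ω => hQ 0 ω
    simp only [add_zero, Nat.cast_zero, image_id'] at hQ0
    simp only [hQ0, integral_indicator_one (hE _)] at hbound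
    rw [h0]
    refine le_of_eq_of_le ?_ hbound
    congr 2
    refine (integral_indicator_one ((hZ.measurable 0 hU).inter (hE _))).symm.trans ?_
    rw [inter_indicator_one]
    rfl
  · by_cases hi : i ∈ {i : ℕ | (i : ℝ) ∈ A} <;> simp [hi]

theorem mul_sum_real_pair_le (u : ℝ) (n : ℕ) {k : ℕ} :
    (n : ℝ) * ∑ j ∈ Finset.Icc 1 (n / k),
        P.real {ω | (u : EReal) < φ (Z 0 ω) ∧ (u : EReal) < φ (Z j ω)} ≤
      C * ((n * μ.real {x | (u : EReal) < φ x}) ^ 2 * (1 / k)) := by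
  set δ := μ.real {x | (u : EReal) < φ x}
  have hU : MeasurableSet {x | (u : EReal) < φ x} := measurableSet_lt measurable_const hφ
  have hsum : ∑ j ∈ Finset.Icc 1 (n / k),
      P.real {ω | (u : EReal) < φ (Z 0 ω) ∧ (u : EReal) < φ (Z j ω)} ≤
        (n / k : ℕ) * (C * δ ^ 2) := by
    simpa using Finset.sum_le_card_nsmul (Finset.Icc 1 (n / k)) _ (C * δ ^ 2) fun j hj =>
      hZ.real_apply_mem_apply_mem_le hp hU (i := 0) (Finset.mem_Icc.1 hj).1
  calc _ ≤ (n : ℝ) * (n / k * (C * δ ^ 2)) := by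
        gcongr
        exact hsum.trans (by gcongr; exact Nat.cast_div_le)
    _ = C * ((n * δ) ^ 2 * (1 / k)) := by ring

variable {u : ℕ → ℝ} {τ : ℝ}
  (hu : Tendsto (fun n : ℕ => (n : ℝ) * μ.real {x | (u n : EReal) < φ x}) atTop (𝓝 τ))

include hu

theorem exists_condD3 : ∃ t : ℕ → ℕ, CondD3 P (fun n ω => φ (Z n ω)) u t := by
  obtain ⟨t, ht_atTop, ht⟩ := exists_tendsto_atTop_tendsto_mul_div (t := fun _ => 1)
    (by simpa using tendsto_one_div_atTop_nhds_zero_nat (𝕜 := ℝ))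
  refine ⟨t, by simpa using ht, fun n s => μ.real {x | (u n : EReal) < φ x} * (1 - c) ^ (s / N),
    fun A hA n s => hZ.abs_real_exceedances_sub_le hp hφ (u n) hA s,
    fun n => hp.antitone_rate.const_mul measureReal_nonneg, ?_⟩
  simpa [mul_assoc] using! hu.mul (hp.tendsto_rate.comp ht_atTop)

theorem condD' {t : ℕ → ℕ} (ht : CondD3 P (fun n ω => φ (Z n ω)) u t) :
    CondD' P (fun n ω => φ (Z n ω)) u t := by
  obtain ⟨k, hk_atTop, hk⟩ := exists_tendsto_atTop_tendsto_mul_div ht.1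
  refine ⟨k, hk_atTop, hk, squeeze_zero (fun n => by positivity)
    (fun n => hZ.mul_sum_real_pair_le hp hφ (u n) n) ?_⟩
  simpa using ((hu.pow 2).mul
    ((tendsto_one_div_atTop_nhds_zero_nat (𝕜 := ℝ)).comp hk_atTop)).const_mul (C : ℝ)

end IsMarkovChain

/-! ### The generating functional of the visits -/

theorem abs_exp_neg_sub_one_sub_le {x δ : ℝ} (hx : x ∈ Icc 0 δ) (hδ : δ ≤ 1) :
    |Real.exp (-x) - (1 - x)| ≤ δ ^ 2 := by
  have h := Real.abs_exp_sub_one_sub_id_le (x := -x)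
    (by rw [abs_neg, abs_of_nonneg hx.1]; exact hx.2.trans hδ)
  rw [neg_sq, sub_neg_eq_add, sub_add] at h
  exact h.trans (pow_le_pow_left₀ hx.1 hx.2 2)

theorem abs_sub_exp_sum_le {G w : ℕ → ℝ} {δ η : ℝ} (hδ : δ ∈ Icc (0 : ℝ) 1)
    (hw : ∀ i, w i ∈ Icc (0 : ℝ) 1) (hG0 : G 0 = 1)
    (hG : ∀ m, |G (m + 1) - (1 - w m * δ) * G m| ≤ η) (m : ℕ) :
    |G m - Real.exp (-(δ * ∑ i ∈ Finset.range m, w i))| ≤ m * (η + δ ^ 2) := by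
  induction m with
  | zero => simp [hG0]
  | succ m ih =>
    set E : ℕ → ℝ := fun m => Real.exp (-(δ * ∑ i ∈ Finset.range m, w i)) with hE
    have hE_le : |E m| ≤ 1 := by
      rw [abs_of_pos (Real.exp_pos _), Real.exp_le_one_iff, neg_nonpos]
      exact mul_nonneg hδ.1 (Finset.sum_nonneg fun i _ => (hw i).1)
    have hE_succ : E (m + 1) = Real.exp (-(w m * δ)) * E m := by
      simp only [hE, ← Real.exp_add, Finset.sum_range_succ]
      congr 1
      ring
    have hx : w m * δ ∈ Icc 0 δ := ⟨mul_nonneg (hw m).1 hδ.1, mul_le_of_le_one_left hδ.1 (hw m).2⟩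
    have hfactor : |1 - w m * δ| ≤ 1 :=
      abs_le.2 ⟨by linarith [hx.2, hδ.2], by linarith [hx.1]⟩
    calc |G (m + 1) - E (m + 1)|
        = |G (m + 1) - (1 - w m * δ) * G m + (1 - w m * δ) * (G m - E m) -
            (Real.exp (-(w m * δ)) - (1 - w m * δ)) * E m| := by
          rw [hE_succ]
          ring_nf
      _ ≤ |G (m + 1) - (1 - w m * δ) * G m| + |1 - w m * δ| * |G m - E m| +
            |Real.exp (-(w m * δ)) - (1 - w m * δ)| * |E m| := by
          rw [← abs_mul, ← abs_mul]
          exact (abs_sub _ _).trans (add_le_add_left (abs_add_le _ _) _)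
      _ ≤ η + 1 * (m * (η + δ ^ 2)) + δ ^ 2 * 1 := by
          gcongr
          exacts [hG m, abs_exp_neg_sub_one_sub_le hx hδ.2]
      _ = (m + 1 : ℕ) * (η + δ ^ 2) := by
          push_cast
          ring

section

variable {M Ω : Type*} [MeasurableSpace M] [MeasurableSpace Ω] {U : Set M} (hU : MeasurableSet U)
  {Z : ℕ → Ω → M} (hZ : ∀ n, Measurable (Z n))

include hU hZ

theorem bddMeas_indicator (n : ℕ) : BddMeas fun ω => U.indicator (1 : M → ℝ) (Z n ω) :=
  (BddMeas.indicator_one hU).comp (hZ n)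

theorem bddMeas_visitProd (w : ℕ → ℝ) (m : ℕ) : BddMeas fun ω => visitProd U w m fun i => Z i ω :=
  (isPast_visitProd hU (Nat.le_succ m)).bddMeas hZ

theorem integral_visitProd_succ {P : Measure Ω} [IsFiniteMeasure P] (w : ℕ → ℝ) (m : ℕ) :
    ∫ ω, visitProd U w (m + 1) (fun i => Z i ω) ∂P =
      ∫ ω, visitProd U w m (fun i => Z i ω) ∂P -
        w m * ∫ ω, visitProd U w m (fun i => Z i ω) * U.indicator 1 (Z m ω) ∂P := by
  have hQ := bddMeas_visitProd hU hZ w m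
  have hQI := hQ.mul (bddMeas_indicator hU hZ m)
  simp only [visitProd_succ]
  rw [integral_sub (hQ.integrable _) ((hQI.integrable _).const_mul _), integral_const_mul]

end

namespace IsMarkovChain

variable {M Ω : Type*} [MeasurableSpace M] [MeasurableSpace Ω] {P : Measure Ω}
  [IsProbabilityMeasure P] {p : Kernel M M} [IsMarkovKernel p] {μ : Measure M}
  [IsProbabilityMeasure μ] {Z : ℕ → Ω → M} (hZ : IsMarkovChain P p μ Z)
  {N : ℕ} {c C : ℝ≥0} (hp : IsDoeblinKernel p μ N c C)

section

variable {U : Set M} (hU : MeasurableSet U) {w : ℕ → ℝ} (hw : ∀ i, w i ∈ Icc (0 : ℝ) 1)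
  {a m t : ℕ} (ham : a ≤ m) (hmt : m ≤ a + t)

include hZ hp hU hw ham hmt

omit [IsMarkovKernel p] [IsProbabilityMeasure μ] in
theorem abs_integral_visitProd_sub_le :
    |∫ ω, visitProd U w a (fun i => Z i ω) ∂P - ∫ ω, visitProd U w m (fun i => Z i ω) ∂P| ≤
      t * μ.real U := by
  have hQ := bddMeas_visitProd hU hZ.measurable w
  have hI := bddMeas_indicator hU hZ.measurable
  have hsub := fun ω => visitProd_sub_visitProd_mem_Icc (U := U) (z := fun i => Z i ω) hw ham
  rw [← integral_sub ((hQ a).integrable _) ((hQ m).integrable _),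
    abs_of_nonneg (integral_nonneg fun ω => (hsub ω).1)]
  calc _ ≤ ∫ ω, ∑ i ∈ Finset.Ico a m, U.indicator 1 (Z i ω) ∂P :=
        integral_mono (((hQ a).sub (hQ m)).integrable _)
          (integrable_finsetSum _ fun i _ => (hI i).integrable _) fun ω => (hsub ω).2
    _ = ∑ i ∈ Finset.Ico a m, ∫ ω, U.indicator 1 (Z i ω) ∂P :=
        integral_finsetSum _ fun i _ => (hI i).integrable _
    _ = (m - a : ℕ) * μ.real U := by
        simp [hZ.integral_apply hp.invariant (.indicator_one hU), integral_indicator_one hU]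
    _ ≤ t * μ.real U := by
        gcongr
        omega

theorem abs_integral_visitProd_mul_indicator_sub_le :
    |∫ ω, visitProd U w m (fun i => Z i ω) * U.indicator 1 (Z m ω) ∂P -
        ∫ ω, visitProd U w a (fun i => Z i ω) * U.indicator 1 (Z m ω) ∂P| ≤
      t * (C * μ.real U ^ 2) := by
  have hI := bddMeas_indicator hU hZ.measurable
  have hQI := fun n => (bddMeas_visitProd hU hZ.measurable w n).mul (hI m)
  have hI0 : ∀ ω, (0 : ℝ) ≤ U.indicator 1 (Z m ω) :=
    fun ω => indicator_nonneg (fun _ _ => zero_le_one) _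
  have hsub := fun ω => visitProd_sub_visitProd_mem_Icc (U := U) (z := fun i => Z i ω) hw ham
  rw [abs_sub_comm, ← integral_sub ((hQI a).integrable _) ((hQI m).integrable _)]
  simp only [← sub_mul]
  rw [abs_of_nonneg (integral_nonneg fun ω => mul_nonneg (hsub ω).1 (hI0 ω))]
  calc _ ≤ ∫ ω, ∑ i ∈ Finset.Ico a m, U.indicator 1 (Z i ω) * U.indicator 1 (Z m ω) ∂P := by
        refine integral_mono (by simpa only [sub_mul] using ((hQI a).sub (hQI m)).integrable P)
          (integrable_finsetSum _ fun i _ => ((hI i).mul (hI m)).integrable _) fun ω => ?_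
        simp only [← Finset.sum_mul]
        exact mul_le_mul_of_nonneg_right (hsub ω).2 (hI0 ω)
    _ = ∑ i ∈ Finset.Ico a m, ∫ ω, U.indicator 1 (Z i ω) * U.indicator 1 (Z m ω) ∂P :=
        integral_finsetSum _ fun i _ => ((hI i).mul (hI m)).integrable _
    _ ≤ (m - a : ℕ) * (C * μ.real U ^ 2) := by
        simpa using Finset.sum_le_card_nsmul (Finset.Ico a m) _ _ fun i hi =>
          hZ.integral_indicator_mul_indicator_le hp hU (Finset.mem_Ico.1 hi).2
    _ ≤ t * (C * μ.real U ^ 2) := by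
        gcongr
        omega

omit ham hmt in
theorem abs_integral_visitProd_mul_indicator_sub_mul_le (hamt : a = 0 ∨ m = a + t) :
    |∫ ω, visitProd U w a (fun i => Z i ω) * U.indicator 1 (Z m ω) ∂P -
        (∫ ω, visitProd U w a (fun i => Z i ω) ∂P) * μ.real U| ≤
      (1 - c) ^ (t / N) * (C * μ.real U) := by
  have hrate := hp.rate_nonneg
  cases a with
  | zero =>
    simp only [visitProd, Finset.range_zero, Finset.prod_empty, one_mul,
      hZ.integral_apply hp.invariant (.indicator_one hU), integral_indicator_one hU]
    simpa using by positivity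
  | succ a =>
    obtain rfl : m = a + 1 + t := hamt.resolve_left a.succ_ne_zero
    rw [add_right_comm]
    refine hZ.abs_integral_mul_indicator_sub_le hp hU (isPast_visitProd hU le_rfl) (fun ω => ?_) t
    have hQ := visitProd_mem_Icc (U := U) (z := fun i => Z i ω) hw (a + 1)
    exact (abs_of_nonneg hQ.1).trans_le hQ.2

omit ham hmt in
theorem abs_integral_visitProd_succ_sub_le (m t : ℕ) :
    |∫ ω, visitProd U w (m + 1) (fun i => Z i ω) ∂P -
        (1 - w m * μ.real U) * ∫ ω, visitProd U w m (fun i => Z i ω) ∂P| ≤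
      μ.real U * ((1 - c) ^ (t / N) * C + t * (C + 1) * μ.real U) := by
  set δ := μ.real U
  obtain ⟨a, ham, hmt, hamt⟩ : ∃ a ≤ m, m ≤ a + t ∧ (a = 0 ∨ m = a + t) :=
    ⟨m - t, by omega, by omega, by omega⟩
  have hpair := hZ.abs_integral_visitProd_mul_indicator_sub_le hp hU hw ham hmt
  have hdecay := hZ.abs_integral_visitProd_mul_indicator_sub_mul_le hp hU hw hamt
  have hmean := hZ.abs_integral_visitProd_sub_le hp hU hw ham hmt
  rw [integral_visitProd_succ hU hZ.measurable]
  set G := ∫ ω, visitProd U w m (fun i => Z i ω) ∂P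
  set Gₐ := ∫ ω, visitProd U w a (fun i => Z i ω) ∂P
  set x := ∫ ω, visitProd U w m (fun i => Z i ω) * U.indicator 1 (Z m ω) ∂P
  set y := ∫ ω, visitProd U w a (fun i => Z i ω) * U.indicator 1 (Z m ω) ∂P
  calc |G - w m * x - (1 - w m * δ) * G|
      = w m * |x - G * δ| := by
        rw [← abs_of_nonneg (hw m).1, ← abs_mul, abs_of_nonneg (hw m).1, ← abs_neg]
        ring_nf
    _ ≤ |x - G * δ| := mul_le_of_le_one_left (abs_nonneg _) (hw m).2
    _ = |x - y + (y - Gₐ * δ) + (Gₐ - G) * δ| := by ring_nf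
    _ ≤ |x - y| + |y - Gₐ * δ| + |Gₐ - G| * δ := by
        refine (abs_add_three _ _ _).trans_eq ?_
        rw [abs_mul, abs_of_nonneg (measureReal_nonneg : 0 ≤ δ)]
    _ ≤ t * (C * δ ^ 2) + (1 - c) ^ (t / N) * (C * δ) + t * δ * δ := by
        gcongr
    _ = δ * ((1 - c) ^ (t / N) * C + t * (C + 1) * δ) := by ring

omit ham hmt in
theorem abs_integral_visitProd_sub_exp_le (m t : ℕ) :
    |∫ ω, visitProd U w m (fun i => Z i ω) ∂P -
        Real.exp (-(μ.real U * ∑ i ∈ Finset.range m, w i))| ≤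
      m * μ.real U * ((1 - c) ^ (t / N) * C + t * (C + 1) * μ.real U + μ.real U) := by
  have h := abs_sub_exp_sum_le (G := fun m => ∫ ω, visitProd U w m (fun i => Z i ω) ∂P)
    ⟨measureReal_nonneg, measureReal_le_one⟩ hw (by simp [visitProd])
    (fun m => hZ.abs_integral_visitProd_succ_sub_le hp hU hw m t) m
  exact h.trans_eq (by ring)

end

include hZ hp

/-- At every step the recursion `G (m + 1) ≈ (1 - w m * δ) * G m` loses `o(δ)`, and there are
`O(1 / δ)` steps. -/
theorem tendsto_integral_visitProd {U : ℕ → Set M} (hU : ∀ n, MeasurableSet (U n))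
    (hδ : Tendsto (fun n => μ.real (U n)) atTop (𝓝 0)) {L : ℕ → ℕ} {K : ℝ}
    (hL : ∀ᶠ n in atTop, L n * μ.real (U n) ≤ K) {w : ℕ → ℕ → ℝ}
    (hw : ∀ n i, w n i ∈ Icc (0 : ℝ) 1) {Λ : ℝ}
    (hΛ : Tendsto (fun n => μ.real (U n) * ∑ i ∈ Finset.range (L n), w n i) atTop (𝓝 Λ)) :
    Tendsto (fun n => ∫ ω, visitProd (U n) (w n) (L n) (fun i => Z i ω) ∂P) atTop
      (𝓝 (Real.exp (-Λ))) := by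
  set δ : ℕ → ℝ := fun n => μ.real (U n)
  set E : ℕ → ℝ := fun n => Real.exp (-(δ n * ∑ i ∈ Finset.range (L n), w n i))
  have hE : Tendsto E atTop (𝓝 (Real.exp (-Λ))) := hΛ.neg.rexp
  set err : ℕ → ℕ → ℝ := fun t n => (1 - c) ^ (t / N) * C + t * (C + 1) * δ n + δ n with herr
  have hbound : ∀ t, ∀ᶠ n in atTop,
      |∫ ω, visitProd (U n) (w n) (L n) (fun i => Z i ω) ∂P - E n| ≤ K * err t n := by
    intro t
    have hrate := hp.rate_nonneg
    filter_upwards [hL] with n hLn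
    exact (hZ.abs_integral_visitProd_sub_exp_le hp (hU n) (hw n) (L n) t).trans
      (mul_le_mul_of_nonneg_right hLn (by positivity))
  have herr_n : ∀ t, Tendsto (fun n => K * err t n) atTop (𝓝 (K * ((1 - c) ^ (t / N) * C))) := by
    intro t
    simpa [herr] using (((hδ.const_mul (t * (C + 1 : ℝ))).const_add _).add hδ).const_mul K
  have herr_t : Tendsto (fun t : ℕ => K * ((1 - (c : ℝ)) ^ (t / N) * C)) atTop (𝓝 0) := by
    simpa using (hp.tendsto_rate.mul_const (C : ℝ)).const_mul K
  suffices h : Tendsto (fun n => ∫ ω, visitProd (U n) (w n) (L n) (fun i => Z i ω) ∂P - E n)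
      atTop (𝓝 0) by simpa using h.add hE
  refine Metric.tendsto_nhds.2 fun ε hε => ?_
  obtain ⟨t, ht⟩ := (herr_t.eventually_lt_const hε).exists
  filter_upwards [hbound t, (herr_n t).eventually_lt_const ht] with n hn hn'
  rw [dist_zero_right]
  exact hn.trans_lt hn'

end IsMarkovChain

/-! ### Convergence in distribution from Laplace transforms -/

theorem tendsto_of_forall_mem_submonoid {E ι : Type*} [TopologicalSpace E] [CompactSpace E]
    [PolishSpace E] [MeasurableSpace E] [BorelSpace E] {l : Filter ι}
    {S : Submonoid (BoundedContinuousFunction E ℝ)}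
    (hS : ∀ x y, x ≠ y → ∃ f ∈ S, f x ≠ f y) {ν : ι → ProbabilityMeasure E}
    {ν' : ProbabilityMeasure E}
    (h : ∀ f ∈ S, Tendsto (fun n => ∫ x, f x ∂(ν n : Measure E)) l
      (𝓝 (∫ x, f x ∂(ν' : Measure E)))) :
    Tendsto ν l (𝓝 ν') := by
  have hstar : star (S : Set (BoundedContinuousFunction E ℝ)) = S := by
    ext f
    rw [Set.mem_star, show star f = f from BoundedContinuousFunction.ext fun _ => star_trivial _]
  refine ProbabilityMeasure.tendsto_of_tight_of_separatesPoints ℝ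
    (A := StarAlgebra.adjoin ℝ (S : Set (BoundedContinuousFunction E ℝ)))
    IsTightMeasureSet.of_compactSpace (fun x y hxy => ?_) fun f hf => ?_
  · obtain ⟨f, hf, hne⟩ := hS x y hxy
    exact ⟨f, ⟨_, ⟨f, StarAlgebra.subset_adjoin ℝ _ hf, rfl⟩, rfl⟩, hne⟩
  · rw [← StarSubalgebra.mem_toSubalgebra, ← Subalgebra.mem_toSubmodule,
      StarAlgebra.adjoin_eq_span, hstar, union_self, Submonoid.closure_eq] at hf
    induction hf using Submodule.span_induction with
    | mem f hf => exact h f hf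
    | zero => simpa using tendsto_const_nhds
    | add f g _ _ ihf ihg =>
      simp only [BoundedContinuousFunction.add_apply]
      simp only [integral_add (f.integrable _) (g.integrable _)]
      exact ihf.add ihg
    | smul a f _ ih =>
      simp only [BoundedContinuousFunction.smul_apply, integral_smul]
      exact ih.const_smul a

/-- The function `exp (-x)` on `[0, ∞]`, with value `0` at `∞`; the test functions of Laplace
transforms of random counts. -/
noncomputable def expNeg (x : ℝ≥0∞) : ℝ := ((EReal.exp x)⁻¹).toReal

theorem expNeg_inv_ne_top (x : ℝ≥0∞) : (EReal.exp x)⁻¹ ≠ ∞ := by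
  rw [ENNReal.inv_ne_top]
  simp

theorem continuous_expNeg : Continuous expNeg :=
  ENNReal.continuousOn_toReal.comp_continuous
    (ENNReal.continuous_exp.comp continuous_coe_ennreal_ereal).inv expNeg_inv_ne_top

theorem expNeg_injective : Function.Injective expNeg := fun x y h => by
  have hinv := (ENNReal.toReal_eq_toReal_iff' (expNeg_inv_ne_top x) (expNeg_inv_ne_top y)).1 h
  exact_mod_cast EReal.exp_strictMono.injective (inv_injective hinv)

theorem expNeg_add (x y : ℝ≥0∞) : expNeg (x + y) = expNeg x * expNeg y := by
  rw [expNeg, EReal.coe_ennreal_add, EReal.exp_add, ENNReal.mul_inv (by simp) (by simp),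
    ENNReal.toReal_mul, expNeg, expNeg]

theorem expNeg_zero : expNeg 0 = 1 := by simp [expNeg]

theorem expNeg_natCast (n : ℕ) : expNeg n = Real.exp (-n) := by
  have hn : ((n : ℝ≥0∞) : EReal) = ((n : ℝ) : EReal) := rfl
  rw [expNeg, hn, EReal.exp_coe, ENNReal.toReal_inv, ENNReal.toReal_ofReal (Real.exp_pos _).le,
    Real.exp_neg]

theorem expNeg_sum {ι : Type*} (s : Finset ι) (f : ι → ℝ≥0∞) :
    expNeg (∑ i ∈ s, f i) = ∏ i ∈ s, expNeg (f i) := by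
  induction s using Finset.cons_induction with
  | empty => simp [expNeg_zero]
  | cons a s ha ih => rw [Finset.sum_cons, Finset.prod_cons, expNeg_add, ih]

section monomial

variable {ι : Type*} [Fintype ι]

/-- The monomial `x ↦ ∏ j, exp (-a j * x j)` on `[0, ∞]^ι`. -/
noncomputable def expNegMonomial (a : ι → ℕ) : BoundedContinuousFunction (ι → ℝ≥0∞) ℝ :=
  .mkOfCompact ⟨fun x => ∏ j, expNeg (x j) ^ a j,
    continuous_finsetProd _ fun j _ => (continuous_expNeg.comp (continuous_apply j)).pow _⟩

theorem expNegMonomial_apply (a : ι → ℕ) (x : ι → ℝ≥0∞) :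
    expNegMonomial a x = ∏ j, expNeg (x j) ^ a j := rfl

theorem expNegMonomial_single [DecidableEq ι] (j : ι) (x : ι → ℝ≥0∞) :
    expNegMonomial (Pi.single j 1) x = expNeg (x j) := by
  rw [expNegMonomial_apply, Finset.prod_eq_single j] <;> simp +contextual

variable (ι) in
/-- The monomials `expNegMonomial a`, closed under multiplication. -/
noncomputable def expNegMonomials : Submonoid (BoundedContinuousFunction (ι → ℝ≥0∞) ℝ) where
  carrier := Set.range expNegMonomial
  one_mem' := ⟨0, by ext; simp [expNegMonomial_apply]⟩
  mul_mem' := by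
    rintro _ _ ⟨a, rfl⟩ ⟨b, rfl⟩
    exact ⟨a + b, by ext; simp [expNegMonomial_apply, pow_add, Finset.prod_mul_distrib]⟩

theorem tendstoInDistribution_of_tendsto_integral_prod_expNeg {Ω Ω' : Type*} [MeasurableSpace Ω]
    [MeasurableSpace Ω'] {P : Measure Ω} [IsProbabilityMeasure P] {Q : Measure Ω'}
    [IsProbabilityMeasure Q] {V : ℕ → Ω → ι → ℝ≥0∞} {W : Ω' → ι → ℝ≥0∞}
    (hV : ∀ n, Measurable (V n)) (hW : Measurable W)
    (h : ∀ a : ι → ℕ, Tendsto (fun n => ∫ ω, ∏ j, expNeg (V n ω j) ^ a j ∂P) atTop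
      (𝓝 (∫ ω, ∏ j, expNeg (W ω j) ^ a j ∂Q))) :
    TendstoInDistribution V atTop W (fun _ => P) Q where
  forall_aemeasurable n := (hV n).aemeasurable
  aemeasurable_limit := hW.aemeasurable
  tendsto := by
    classical
    refine tendsto_of_forall_mem_submonoid (S := expNegMonomials ι) (fun x y hxy => ?_) ?_
    · obtain ⟨j, hj⟩ := Function.ne_iff.1 hxy
      refine ⟨expNegMonomial (Pi.single j 1), ⟨_, rfl⟩, ?_⟩
      rw [expNegMonomial_single, expNegMonomial_single]
      exact expNeg_injective.ne hj
    · rintro _ ⟨a, rfl⟩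
      have ha {m : Measure (ι → ℝ≥0∞)} : AEStronglyMeasurable (expNegMonomial a) m :=
        (expNegMonomial a).continuous.aestronglyMeasurable
      simp only [ProbabilityMeasure.coe_mk, integral_map (hV _).aemeasurable ha,
        integral_map hW.aemeasurable ha]
      exact h a

end monomial

/-! ### Riemann sums and sets of the ring -/

theorem indicator_floor_eq_sum {δ : ℝ} (hδ : 0 < δ) {g : ℝ → ℝ} {L : ℕ}
    (hg : ∀ x, L * δ ≤ x → g x = 0) :
    (Ici (0 : ℝ)).indicator (fun x => g (⌊x / δ⌋₊ * δ)) =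
      fun x => ∑ i ∈ Finset.range L,
        (Ico (i * δ) ((i + 1) * δ)).indicator (fun _ => g (i * δ)) x := by
  ext x
  by_cases hx : 0 ≤ x
  · have hmem (i : ℕ) : x ∈ Ico (i * δ) ((i + 1) * δ) ↔ ⌊x / δ⌋₊ = i := by
      rw [Nat.floor_eq_iff (by positivity), le_div_iff₀ hδ, div_lt_iff₀ hδ, mem_Ico]
    rw [indicator_of_mem (mem_Ici.2 hx)]
    simp only [indicator, hmem, Finset.sum_ite_eq, Finset.mem_range]
    split_ifs with h
    · rfl
    · exact hg _ (by gcongr; exact not_lt.1 h)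
  · rw [indicator_of_notMem (mem_Ici.not.2 hx), eq_comm]
    exact Finset.sum_eq_zero fun i _ =>
      indicator_of_notMem (fun h => hx (le_trans (by positivity) h.1)) _

theorem integral_Ici_floor_eq_sum {δ : ℝ} (hδ : 0 < δ) {g : ℝ → ℝ} {L : ℕ}
    (hg : ∀ x, L * δ ≤ x → g x = 0) :
    ∫ x in Ici (0 : ℝ), g (⌊x / δ⌋₊ * δ) = δ * ∑ i ∈ Finset.range L, g (i * δ) := by
  rw [← integral_indicator measurableSet_Ici, indicator_floor_eq_sum hδ hg, integral_finsetSum,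
    Finset.mul_sum]
  · refine Finset.sum_congr rfl fun i _ => ?_
    rw [integral_indicator_const _ measurableSet_Ico, Real.volume_real_Ico_of_le (by gcongr; simp),
      smul_eq_mul]
    ring
  · exact fun i _ => (integrable_indicator_iff measurableSet_Ico).2
      (integrableOn_const measure_Ico_lt_top.ne)

theorem sub_le_floor_div_mul {x δ : ℝ} (hδ : 0 < δ) : x - δ ≤ ⌊x / δ⌋₊ * δ := by
  have h := (Nat.lt_floor_add_one (x / δ)).le
  rw [div_le_iff₀ hδ] at h
  linarith

theorem floor_div_mul_le {x δ : ℝ} (hx : 0 ≤ x) (hδ : 0 < δ) : ⌊x / δ⌋₊ * δ ≤ x :=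
  (le_div_iff₀ hδ).1 (Nat.floor_le (by positivity))

theorem tendsto_floor_div_mul {ι : Type*} {l : Filter ι} {δ : ι → ℝ} (hδ : Tendsto δ l (𝓝[>] 0))
    {x : ℝ} (hx : 0 ≤ x) : Tendsto (fun n => ⌊x / δ n⌋₊ * δ n) l (𝓝 x) := by
  rw [tendsto_nhdsWithin_iff] at hδ
  refine tendsto_of_tendsto_of_tendsto_of_le_of_le' (g := fun n => x - δ n)
    (by simpa using hδ.1.const_sub x) tendsto_const_nhds ?_ ?_
  · filter_upwards [hδ.2] with n hn using sub_le_floor_div_mul hn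
  · filter_upwards [hδ.2] with n hn using floor_div_mul_le hx hn

theorem tendsto_mul_sum_range_integral_Ici {g : ℝ → ℝ} (hg : Measurable g) {b : ℝ}
    (hb : ∀ x, |g x| ≤ b) {K : ℝ} (hK : ∀ x, K ≤ x → g x = 0) (hc : ∀ᵐ x : ℝ, ContinuousAt g x)
    {ι : Type*} {l : Filter ι} [l.IsCountablyGenerated] {δ : ι → ℝ} (hδ : Tendsto δ l (𝓝[>] 0))
    {L : ι → ℕ} (hL : ∀ᶠ n in l, K ≤ L n * δ n) :
    Tendsto (fun n => δ n * ∑ i ∈ Finset.range (L n), g (i * δ n)) l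
      (𝓝 (∫ x in Ici (0 : ℝ), g x)) := by
  obtain ⟨hδ0, hδpos⟩ := tendsto_nhdsWithin_iff.1 hδ
  have hlim : Tendsto (fun n => ∫ x in Ici (0 : ℝ), g (⌊x / δ n⌋₊ * δ n)) l
      (𝓝 (∫ x in Ici (0 : ℝ), g x)) := by
    refine tendsto_integral_filter_of_dominated_convergence ((Iic (K + 1)).indicator fun _ => b)
      (.of_forall fun n => Measurable.aestronglyMeasurable (by fun_prop)) ?_ ?_ ?_
    · filter_upwards [hδpos, hδ0.eventually (gt_mem_nhds one_pos)] with n hn hn1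
      refine ae_of_all _ fun x => ?_
      by_cases hx : x ≤ K + 1
      · rw [indicator_of_mem (mem_Iic.2 hx)]
        exact hb _
      · rw [indicator_of_notMem (mem_Iic.not.2 hx), hK, norm_zero]
        linarith [sub_le_floor_div_mul (x := x) hn]
    · refine (integrable_indicator_iff measurableSet_Iic).2 (integrableOn_const ?_)
      rw [Measure.restrict_apply measurableSet_Iic, Iic_inter_Ici]
      exact measure_Icc_lt_top.ne
    · filter_upwards [ae_restrict_of_ae hc, ae_restrict_mem measurableSet_Ici] with x hx hx0
      exact hx.tendsto.comp (tendsto_floor_div_mul hδ hx0)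
  refine hlim.congr' ?_
  filter_upwards [hδpos, hL] with n hn hLn
  exact integral_Ici_floor_eq_sum hn fun x hx => hK x (hLn.trans hx)

theorem exists_eventually_nat_mul_mem_Icc {ι : Type*} {l : Filter ι} {δ : ι → ℝ}
    (hδ : Tendsto δ l (𝓝[>] 0)) {K : ℝ} (hK : 0 ≤ K) :
    ∃ L : ι → ℕ, ∀ᶠ n in l, L n * δ n ∈ Icc K (K + 1) := by
  obtain ⟨hδ0, hδpos⟩ := tendsto_nhdsWithin_iff.1 hδ
  refine ⟨fun n => ⌈K / δ n⌉₊, ?_⟩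
  filter_upwards [hδpos, hδ0.eventually (gt_mem_nhds one_pos)] with n hn hn1
  refine ⟨(div_le_iff₀ hn).1 (Nat.le_ceil _), ?_⟩
  calc (⌈K / δ n⌉₊ : ℝ) * δ n ≤ (K / δ n + 1) * δ n :=
        mul_le_mul_of_nonneg_right (Nat.ceil_lt_add_one (div_nonneg hK hn.le)).le hn.le
    _ = K + δ n := by rw [add_mul, div_mul_cancel₀ _ hn.ne', one_mul]
    _ ≤ K + 1 := by gcongr

theorem InRing.measurableSet {A : Set ℝ} (hA : InRing A) : MeasurableSet A := by
  obtain ⟨s, -, rfl⟩ := hA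
  exact Finset.measurableSet_biUnion _ fun I _ => measurableSet_Ico

theorem InRing.volume_ne_top {A : Set ℝ} (hA : InRing A) : volume A ≠ ∞ := by
  obtain ⟨s, -, rfl⟩ := hA
  exact (measure_biUnion_lt_top s.finite_toSet fun I _ => measure_Ico_lt_top).ne

theorem InRing.ae_notMem_frontier {A : Set ℝ} (hA : InRing A) : ∀ᵐ x : ℝ, x ∉ frontier A := by
  obtain ⟨s, -, rfl⟩ := hA
  induction s using Finset.cons_induction with
  | empty => simp
  | cons I s hI ih =>
    filter_upwards [ih, measure_eq_zero_iff_ae_notMem.1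
      ((convex_Ico I.1 I.2).addHaar_frontier volume)] with x hs hI hx
    rw [Finset.cons_eq_insert, Finset.set_biUnion_insert] at hx
    exact (frontier_union_subset _ _ hx).elim (fun h => hI h.1) fun h => hs h.2

section laplaceRate

variable {ι : Type*} [Fintype ι] {J : ι → Set ℝ} {a : ι → ℕ}

/-- `1 - exp (-w x)`, where `w x` is the sum of the `a j` with `x ∈ J j`. Its integral is minus the
logarithm of the joint Laplace transform at `a` of the masses that a Poisson process of intensity
`1` gives to the sets `J j`. -/
noncomputable def laplaceRate (J : ι → Set ℝ) (a : ι → ℕ) (x : ℝ) : ℝ :=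
  1 - Real.exp (-∑ j, (J j).indicator (fun _ => (a j : ℝ)) x)

theorem laplaceRate_mem_Icc (x : ℝ) : laplaceRate J a x ∈ Icc (0 : ℝ) 1 := by
  have hw : 0 ≤ ∑ j, (J j).indicator (fun _ => (a j : ℝ)) x :=
    Finset.sum_nonneg fun j _ => indicator_nonneg (fun _ _ => (a j).cast_nonneg) x
  exact ⟨sub_nonneg.2 (Real.exp_le_one_iff.2 (neg_nonpos.2 hw)), sub_le_self _ (Real.exp_pos _).le⟩

theorem abs_laplaceRate_le (x : ℝ) : |laplaceRate J a x| ≤ 1 :=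
  (abs_of_nonneg (laplaceRate_mem_Icc x).1).trans_le (laplaceRate_mem_Icc x).2

theorem measurable_laplaceRate (hJ : ∀ j, MeasurableSet (J j)) : Measurable (laplaceRate J a) := by
  have (j : ι) : Measurable ((J j).indicator fun _ => (a j : ℝ)) :=
    measurable_const.indicator (hJ j)
  unfold laplaceRate
  fun_prop

theorem laplaceRate_eq_zero {x : ℝ} (hx : ∀ j, x ∉ J j) : laplaceRate J a x = 0 := by
  simp [laplaceRate, hx]

theorem ae_continuousAt_laplaceRate (hJ : ∀ j, InRing (J j)) :
    ∀ᵐ x : ℝ, ContinuousAt (laplaceRate J a) x := by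
  filter_upwards [ae_all_iff.2 fun j => (hJ j).ae_notMem_frontier] with x hx
  have (j : ι) : ContinuousAt ((J j).indicator fun _ => (a j : ℝ)) x :=
    continuousOn_const.continuousAt_indicator (hx j)
  unfold laplaceRate
  fun_prop

theorem one_sub_laplaceRate (x : ℝ) :
    1 - laplaceRate J a x = ∏ j, Real.exp (-(J j).indicator (fun _ => (a j : ℝ)) x) := by
  rw [laplaceRate, sub_sub_cancel, ← Finset.sum_neg_distrib, Real.exp_sum]

end laplaceRate

/-! ### The Laplace transform of a Poisson process -/

section cell

variable {ι : Type*} {J : ι → Set ℝ}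

/-- The atom of the algebra of sets generated by the `J j` on which membership is prescribed by `S`.
Only the part inside `⋃ j, J j` is taken, so that for `S = ∅` the atom is empty. -/
def cell (J : ι → Set ℝ) (S : Finset ι) : Set ℝ :=
  {x | x ∈ ⋃ j, J j ∧ ∀ j, x ∈ J j ↔ j ∈ S}

theorem cell_subset_iUnion (S : Finset ι) : cell J S ⊆ ⋃ j, J j := fun _ hx => hx.1

theorem pairwise_disjoint_cell : Pairwise fun S T => Disjoint (cell J S) (cell J T) :=
  fun _ _ hST => Set.disjoint_left.2 fun _ hS hT =>
    hST (Finset.ext fun j => (hS.2 j).symm.trans (hT.2 j))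

theorem measurableSet_cell [Countable ι] (hJ : ∀ j, MeasurableSet (J j))
    (S : Finset ι) : MeasurableSet (cell J S) := by
  simp only [cell, Set.ofPred_and, Set.ofPred_forall]
  refine (MeasurableSet.iUnion hJ).inter (MeasurableSet.iInter fun j => ?_)
  by_cases hj : j ∈ S
  · simpa only [hj, iff_true] using! hJ j
  · simpa only [hj, iff_false] using! (hJ j).compl

theorem exists_mem_cell [Finite ι] {x : ℝ} (hx : x ∈ ⋃ j, J j) : ∃ S, x ∈ cell J S :=
  ⟨(Set.toFinite {j | x ∈ J j}).toFinset, hx, fun j => by simp⟩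

variable [Fintype ι]

theorem biUnion_cell [DecidableEq ι] (j : ι) :
    ⋃ S ∈ Finset.univ.filter (j ∈ ·), cell J S = J j := by
  ext x
  simp only [mem_iUnion, Finset.mem_filter, Finset.mem_univ, true_and, exists_prop]
  constructor
  · rintro ⟨S, hjS, hS⟩
    exact (hS.2 j).2 hjS
  · intro hx
    obtain ⟨S, hS⟩ := exists_mem_cell (mem_iUnion_of_mem j hx)
    exact ⟨S, (hS.2 j).1 hx, hS⟩

theorem laplaceRate_eq_sum_cell (a : ι → ℕ) (x : ℝ) :
    laplaceRate J a x =
      ∑ S, (cell J S).indicator (fun _ => 1 - Real.exp (-((∑ j ∈ S, a j : ℕ) : ℝ))) x := by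
  classical
  by_cases hx : x ∈ ⋃ j, J j
  · obtain ⟨S, hS⟩ := exists_mem_cell hx
    rw [Finset.sum_eq_single S, indicator_of_mem hS, laplaceRate]
    · simp [indicator, hS.2]
    · exact fun T _ hTS =>
        indicator_of_notMem (fun hT => Set.disjoint_left.1 (pairwise_disjoint_cell hTS) hT hS) _
    · simp
  · rw [laplaceRate_eq_zero fun j hj => hx (mem_iUnion_of_mem j hj)]
    exact (Finset.sum_eq_zero fun S _ =>
      indicator_of_notMem (fun h => hx (cell_subset_iUnion S h)) _).symm

theorem prod_expNeg_pow_eq_prod_cell (hJ : ∀ j, MeasurableSet (J j)) (a : ι → ℕ) (m : Measure ℝ) :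
    ∏ j, expNeg (m (J j)) ^ a j = ∏ S, expNeg (m (cell J S)) ^ ∑ j ∈ S, a j := by
  classical
  have hm (j : ι) : m (J j) = ∑ S ∈ Finset.univ.filter (j ∈ ·), m (cell J S) := by
    rw [← measure_biUnion_finset (pairwise_disjoint_cell.set_pairwise _)
      fun S _ => measurableSet_cell hJ S, biUnion_cell]
  simp only [hm, expNeg_sum, ← Finset.prod_pow, Finset.prod_filter, ← Finset.prod_pow_eq_pow_sum]
  rw [Finset.prod_comm]
  refine Finset.prod_congr rfl fun S _ => ?_
  simp [ite_pow, Finset.prod_ite_mem]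

end cell

theorem integral_expNeg_pow_poissonMeasure (r : ℝ≥0) (s : ℕ) :
    ∫ n, expNeg ((n : ℕ) : ℝ≥0∞) ^ s ∂(poissonMeasure r) =
      Real.exp (-((1 - Real.exp (-s)) * r)) := by
  have hsum := (NormedSpace.expSeries_div_hasSum_exp ((r : ℝ) * Real.exp (-s))).mul_left
    (Real.exp (-r))
  rw [← Real.exp_eq_exp_ℝ, ← Real.exp_add] at hsum
  rw [integral_poissonMeasure,
    show -((1 - Real.exp (-(s : ℝ))) * (r : ℝ)) = -(r : ℝ) + r * Real.exp (-s) by ring,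
    ← hsum.tsum_eq]
  refine tsum_congr fun n => ?_
  rw [expNeg_natCast, smul_eq_mul, mul_pow, ← Real.exp_nat_mul, ← Real.exp_nat_mul,
    mul_neg, mul_neg, mul_comm (s : ℝ)]
  ring

namespace IsPoissonProcess

variable {Ω' : Type*} [MeasurableSpace Ω'] {Q : Measure Ω'} {N : Ω' → Measure ℝ}
  (hN : IsPoissonProcess Q N)

include hN

theorem measurable_apply {B : Set ℝ} (hB : MeasurableSet B) : Measurable fun ω => N ω B :=
  (Measure.measurable_coe hB).comp hN.measurable

theorem integral_expNeg_pow {B : Set ℝ} (hB : MeasurableSet B) (hB0 : B ⊆ Ici 0)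
    (hBt : volume B ≠ ∞) (s : ℕ) :
    ∫ ω, expNeg (N ω B) ^ s ∂Q = Real.exp (-((1 - Real.exp (-s)) * volume.real B)) := by
  have hm : Measurable fun x => expNeg x ^ s := (continuous_expNeg.pow s).measurable
  rw [← integral_map (hN.measurable_apply hB).aemeasurable hm.aestronglyMeasurable,
    hN.law B hB hB0 hBt, integral_map (by fun_prop) hm.aestronglyMeasurable,
    integral_expNeg_pow_poissonMeasure]
  rfl

theorem iIndepFun_apply {ι : Type*} [Finite ι] {B : ι → Set ℝ} (hB : ∀ i, MeasurableSet (B i))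
    (hB0 : ∀ i, B i ⊆ Ici 0) (hdisj : Pairwise fun i j => Disjoint (B i) (B j)) :
    iIndepFun (fun i ω => N ω (B i)) Q := by
  let e := Finite.equivFin ι
  have h := (hN.indep _ (fun i => B (e.symm i)) (fun i => hB _) (fun i => hB0 _)
    fun i j hij => hdisj (e.symm.injective.ne hij)).precomp e.injective
  simpa using h

theorem integral_prod_expNeg [IsProbabilityMeasure Q] {ι : Type*} [Fintype ι] {J : ι → Set ℝ}
    (hJ : ∀ j, MeasurableSet (J j)) (hJ0 : ∀ j, J j ⊆ Ici 0) (hJt : ∀ j, volume (J j) ≠ ∞)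
    (a : ι → ℕ) :
    ∫ ω, ∏ j, expNeg (N ω (J j)) ^ a j ∂Q = Real.exp (-∫ x, laplaceRate J a x) := by
  have hcell := measurableSet_cell hJ
  have hcell0 (S : Finset ι) : cell J S ⊆ Ici 0 := (cell_subset_iUnion S).trans (iUnion_subset hJ0)
  have hcellt (S : Finset ι) : volume (cell J S) ≠ ∞ :=
    measure_ne_top_of_subset (cell_subset_iUnion S)
      (by simpa using (measure_biUnion_lt_top finite_univ fun j _ => (hJt j).lt_top).ne)
  have hexp (s : ℕ) : Measurable fun x => expNeg x ^ s := (continuous_expNeg.pow s).measurable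
  have hindep : iIndepFun (fun S ω => expNeg (N ω (cell J S)) ^ ∑ j ∈ S, a j) Q :=
    (hN.iIndepFun_apply hcell hcell0 pairwise_disjoint_cell).comp _ fun S => hexp (∑ j ∈ S, a j)
  have hrate : ∫ x, laplaceRate J a x =
      ∑ S, (1 - Real.exp (-((∑ j ∈ S, a j : ℕ) : ℝ))) * volume.real (cell J S) := by
    simp only [laplaceRate_eq_sum_cell]
    rw [integral_finsetSum]
    · simp only [integral_indicator_const _ (hcell _), smul_eq_mul, mul_comm]
    · exact fun S _ => (integrable_indicator_iff (hcell S)).2 (integrableOn_const (hcellt S))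
  simp only [prod_expNeg_pow_eq_prod_cell hJ]
  rw [hindep.integral_fun_prod_eq_prod_integral fun S =>
    ((hexp _).comp (hN.measurable_apply (hcell S))).aestronglyMeasurable]
  simp only [hN.integral_expNeg_pow (hcell _) (hcell0 _) (hcellt _)]
  rw [← Real.exp_sum, Finset.sum_neg_distrib, hrate]

end IsPoissonProcess

/-! ### Poisson limits for Doeblin chains -/

theorem natCast_mem_image_inv_mul_iff {δ : ℝ} (hδ : δ ≠ 0) {J : Set ℝ} {i : ℕ} :
    (i : ℝ) ∈ (fun s => δ⁻¹ * s) '' J ↔ i * δ ∈ J := by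
  constructor
  · rintro ⟨x, hx, hxi⟩
    rwa [← hxi, mul_comm, mul_inv_cancel_left₀ hδ]
  · exact fun h => ⟨_, h, by field_simp⟩

theorem prod_expNeg_exceedances {M Ω ι : Type*} [Fintype ι] {φ : M → EReal} {v δ : ℝ} (hδ : 0 < δ)
    {J : ι → Set ℝ} (a : ι → ℕ) {L : ℕ} (hL : ∀ j, ∀ x ∈ J j, x < L * δ) (Z : ℕ → Ω → M) (ω : Ω) :
    ∏ j, expNeg (exceedances (fun n ω => φ (Z n ω)) v ((fun s => δ⁻¹ * s) '' J j) ω) ^ a j =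
      visitProd {x | (v : EReal) < φ x} (fun i => laplaceRate J a (i * δ)) L fun i => Z i ω := by
  have hlt (j : ι) (i : ℕ) (hi : (i : ℝ) ∈ (fun s => δ⁻¹ * s) '' J j) : i < L := by
    have h := hL j _ ((natCast_mem_image_inv_mul_iff hδ.ne').1 hi)
    exact_mod_cast lt_of_mul_lt_mul_right h hδ.le
  simp only [exceedances_eq_sum (hlt _), expNeg_sum, ← Finset.prod_pow]
  rw [Finset.prod_comm, visitProd]
  refine Finset.prod_congr rfl fun i _ => ?_
  by_cases hi : (v : EReal) < φ (Z i ω)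
  · rw [indicator_of_mem (by exact hi), Pi.one_apply, mul_one, one_sub_laplaceRate]
    refine Finset.prod_congr rfl fun j _ => ?_
    by_cases hij : i * δ ∈ J j
    · simpa [indicator, natCast_mem_image_inv_mul_iff hδ.ne', hi, hij, ← Real.exp_nat_mul] using
        congrArg (· ^ a j) (expNeg_natCast 1)
    · simp [indicator, natCast_mem_image_inv_mul_iff hδ.ne', hij, expNeg_zero]
  · rw [indicator_of_notMem (by exact hi), mul_zero, sub_zero]
    exact Finset.prod_eq_one fun j _ => by simp [indicator, hi, expNeg_zero]

namespace IsMarkovChain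

variable {M Ω : Type*} [MeasurableSpace M] [MeasurableSpace Ω] {P : Measure Ω}
  [IsProbabilityMeasure P] {p : Kernel M M} [IsMarkovKernel p] {μ : Measure M}
  [IsProbabilityMeasure μ] {Z : ℕ → Ω → M} {N : ℕ} {c C : ℝ≥0}

theorem tendsto_integral_prod_expNeg_repp (hZ : IsMarkovChain P p μ Z)
    (hp : IsDoeblinKernel p μ N c C) {φ : M → EReal} (hφ : Measurable φ) {u : ℕ → ℝ}
    (hδ : Tendsto (fun n => μ.real {x | (u n : EReal) < φ x}) atTop (𝓝[>] 0))
    {ι : Type*} [Fintype ι] {J : ι → Set ℝ} (hJ : ∀ j, InRing (J j)) (a : ι → ℕ) :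
    Tendsto (fun n => ∫ ω, ∏ j, expNeg (repp P (fun n ω => φ (Z n ω)) u n (J j) ω) ^ a j ∂P) atTop
      (𝓝 (Real.exp (-∫ x, laplaceRate J a x))) := by
  obtain ⟨K, hK⟩ : ∃ K : ℕ, ∀ j, ∀ x ∈ J j, x < K := by
    choose K hK using fun j => (hJ j).exists_lt
    exact ⟨Finset.univ.sup K, fun j x hx =>
      (hK j x hx).trans_le (Nat.cast_le.2 (Finset.le_sup (Finset.mem_univ j)))⟩
  have hU (n : ℕ) : MeasurableSet {x | (u n : EReal) < φ x} :=
    measurableSet_lt measurable_const hφ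
  obtain ⟨L, hL⟩ := exists_eventually_nat_mul_mem_Icc hδ K.cast_nonneg
  rw [← setIntegral_eq_integral_of_forall_compl_eq_zero (s := Ici 0) fun x hx =>
    laplaceRate_eq_zero fun j hj => hx ((hJ j).nonneg hj)]
  have hrate := tendsto_mul_sum_range_integral_Ici
    (measurable_laplaceRate (a := a) fun j => (hJ j).measurableSet) abs_laplaceRate_le
    (fun x hx => laplaceRate_eq_zero fun j hj => (hK j x hj).not_ge hx)
    (ae_continuousAt_laplaceRate hJ) hδ (hL.mono fun n hn => hn.1)
  have hlim := hZ.tendsto_integral_visitProd hp hU (tendsto_nhdsWithin_iff.1 hδ).1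
    (hL.mono fun n hn => hn.2) (fun n i => laplaceRate_mem_Icc _) hrate
  refine hlim.congr' ?_
  filter_upwards [(tendsto_nhdsWithin_iff.1 hδ).2, hL] with n hn hLn
  have hreal : P.real {ω | (u n : EReal) < φ (Z 0 ω)} = μ.real {x | (u n : EReal) < φ x} :=
    hZ.real_apply_mem hp.invariant (hU n) 0
  refine integral_congr_ae (ae_of_all _ fun ω => ?_)
  simp only [repp, hreal]
  exact (prod_expNeg_exceedances hn a (fun j x hx => (hK j x hx).trans_le hLn.1) Z ω).symm

theorem convergesInDistribution_repp (hZ : IsMarkovChain P p μ Z) (hp : IsDoeblinKernel p μ N c C)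
    {φ : M → EReal} (hφ : Measurable φ) {u : ℕ → ℝ}
    (hδ : Tendsto (fun n => μ.real {x | (u n : EReal) < φ x}) atTop (𝓝[>] 0))
    {Ω' : Type*} [MeasurableSpace Ω'] {Q : Measure Ω'} [IsProbabilityMeasure Q]
    {N' : Ω' → Measure ℝ} (hN : IsPoissonProcess Q N') :
    ConvergesInDistribution P (repp P (fun n ω => φ (Z n ω)) u) Q N' := by
  intro k J hJ
  have hJm (j : Fin k) : MeasurableSet (J j) := (hJ j).measurableSet
  refine tendstoInDistribution_of_tendsto_integral_prod_expNeg
    (fun n => measurable_pi_lambda _ fun j =>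
      measurable_exceedances fun i => hφ.comp (hZ.measurable i))
    (measurable_pi_lambda _ fun j => hN.measurable_apply (hJm j)) fun a => ?_
  rw [hN.integral_prod_expNeg hJm (fun j x hx => (hJ j).nonneg hx) fun j => (hJ j).volume_ne_top]
  exact hZ.tendsto_integral_prod_expNeg_repp hp hφ hδ hJ a

theorem hasPoissonRareEvents.{r, s} {M : Type*} {Ω : Type s} [MeasurableSpace M]
    [MeasurableSpace Ω] {P : Measure Ω} [IsProbabilityMeasure P] {p : Kernel M M}
    [IsMarkovKernel p] {μ : Measure M} [IsProbabilityMeasure μ] {Z : ℕ → Ω → M}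
    (hZ : IsMarkovChain P p μ Z) (hp : IsDoeblinKernel p μ N c C) {φ : M → EReal}
    (hφ : Measurable φ) {u : ℕ → ℝ} {τ : ℝ} (hτ : 0 < τ)
    (hu : Tendsto (fun n : ℕ => (n : ℝ) * μ.real {x | (u n : EReal) < φ x}) atTop (𝓝 τ)) :
    HasPoissonRareEvents.{r} P (fun n ω => φ (Z n ω)) u := by
  refine ⟨hZ.exists_condD3 hp hφ hu, fun _ => hZ.condD' hp hφ hu, fun _ _ _ _ _ hN =>
    hZ.convergesInDistribution_repp hp hφ (tendsto_nhdsWithin_iff.2 ⟨?_, ?_⟩) hN⟩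
  · have h := hu.mul (tendsto_const_div_atTop_nhds_zero_nat 1)
    rw [mul_zero] at h
    refine h.congr' ?_
    filter_upwards [eventually_ne_atTop 0] with n hn
    field_simp
  · filter_upwards [hu.eventually (lt_mem_nhds hτ)] with n hn
    exact pos_of_mul_pos_right hn n.cast_nonneg

end IsMarkovChain

/-! ### Pseudo-orbits along a dense sequence -/

section PseudoOrbit

variable {M : Type*} [MetricSpace M] {x : ℕ → M} {r : ℝ}

/-- There is an `r`-pseudo-orbit of length `n` from `x i` to `x j` for the map `x i ↦ x (i + 1)`:
after each step one may jump to a point `x k` at distance less than `r`. Pseudo-orbits are tracked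
by indices, so that the map is well defined even where `x` repeats a value. -/
def PseudoOrbit (x : ℕ → M) (r : ℝ) : ℕ → ℕ → ℕ → Prop
  | 0, i, j => i = j
  | n + 1, i, j => ∃ k, dist (x (i + 1)) (x k) < r ∧ PseudoOrbit x r n k j

theorem PseudoOrbit.trans {m n i j k : ℕ} (h : PseudoOrbit x r m i j)
    (h' : PseudoOrbit x r n j k) : PseudoOrbit x r (m + n) i k := by
  induction m generalizing i with
  | zero => obtain rfl : i = j := h; rwa [zero_add]
  | succ m ih =>
    obtain ⟨l, hl, h⟩ := h
    rw [add_right_comm]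
    exact ⟨l, hl, ih h⟩

theorem pseudoOrbit_one {i j : ℕ} (h : dist (x (i + 1)) (x j) < r) : PseudoOrbit x r 1 i j :=
  ⟨j, h, rfl⟩

theorem pseudoOrbit_add (hr : 0 < r) (n i : ℕ) : PseudoOrbit x r n i (i + n) := by
  induction n with
  | zero => rfl
  | succ n ih => exact ih.trans (pseudoOrbit_one (by rwa [← add_assoc, dist_self]))

theorem pseudoOrbit_sub (hr : 0 < r) {i j m : ℕ} (hm : i < m) (h : dist (x m) (x j) < r) :
    PseudoOrbit x r (m - i) i j := by
  obtain ⟨n, rfl⟩ := Nat.exists_eq_add_of_lt hm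
  rw [add_assoc, Nat.add_sub_cancel_left]
  exact (pseudoOrbit_add hr n i).trans (pseudoOrbit_one h)

theorem exists_finset_iUnion_ball_eq_univ [CompactSpace M] {ι : Type*} {x : ι → M}
    (hx : DenseRange x) (hr : 0 < r) : ∃ s : Finset ι, ⋃ i ∈ s, Metric.ball (x i) r = univ := by
  obtain ⟨s, hs⟩ := isCompact_univ.elim_finite_subcover (fun i => Metric.ball (x i) r)
    (fun _ => Metric.isOpen_ball) fun y _ => by
      obtain ⟨i, hi⟩ := hx.exists_dist_lt y hr
      exact mem_iUnion.2 ⟨i, hi⟩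
  exact ⟨s, univ_subset_iff.1 hs⟩

variable [ConnectedSpace M]

theorem forall_of_forall_dist_lt_imp {ι : Type*} {x : ι → M} (hr : 0 < r) (hx : DenseRange x)
    {s : ι → Prop} (hs : ∀ a b, dist (x a) (x b) < r → s a → s b) {a : ι} (ha : s a) (b : ι) :
    s b := by
  have hopen : IsOpen (closure (x '' {a | s a})) := by
    refine Metric.isOpen_iff.2 fun y hy => ⟨r / 2, half_pos hr, ?_⟩
    refine (hx.open_subset_closure_inter Metric.isOpen_ball).trans (closure_mono ?_)
    rintro _ ⟨hc, c, rfl⟩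
    obtain ⟨_, ⟨d, hd, rfl⟩, hyd⟩ := Metric.mem_closure_iff.1 hy _ (half_pos hr)
    refine ⟨c, hs d c ?_ hd, rfl⟩
    linarith [dist_triangle_left (x d) (x c) y, Metric.mem_ball'.1 hc]
  have huniv : closure (x '' {a | s a}) = univ :=
    IsClopen.eq_univ ⟨isClosed_closure, hopen⟩ ⟨x a, subset_closure ⟨a, ha, rfl⟩⟩
  obtain ⟨_, ⟨c, hc, rfl⟩, hbc⟩ := Metric.mem_closure_iff.1 (huniv ▸ mem_univ (x b)) r hr
  exact hs c b (by rwa [dist_comm]) hc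

theorem exists_gt_dist_lt (hr : 0 < r) (hx : DenseRange x) (i : ℕ) (y : M) :
    ∃ m, i < m ∧ dist (x m) y < r := by
  rcases subsingleton_or_nontrivial M with h | h
  · exact ⟨i + 1, i.lt_succ_self, by rwa [Subsingleton.elim (x (i + 1)) y, dist_self]⟩
  · obtain ⟨_, ⟨⟨m, rfl⟩, hm⟩, hmy⟩ :=
      (hx.sdiff_finite ((finite_Iic i).image x)).exists_mem_open Metric.isOpen_ball
        ⟨y, Metric.mem_ball_self hr⟩
    exact ⟨m, not_le.1 fun hmi => hm ⟨m, hmi, rfl⟩, hmy⟩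

theorem exists_pseudoOrbit (hr : 0 < r) (hx : DenseRange x) (i j : ℕ) :
    ∃ n, PseudoOrbit x r n i j := by
  obtain ⟨m, hm, h⟩ := exists_gt_dist_lt hr hx i (x j)
  exact ⟨_, pseudoOrbit_sub hr hm h⟩

/-- If every return time to `0` is divisible by `g`, then divisibility of an index by `g` passes to
all indices of nearby points, hence by connectedness from `0` to `1`. -/
theorem setGcd_pseudoOrbit (hr : 0 < r) (hx : DenseRange x) :
    Nat.setGcd {n | PseudoOrbit x r n 0 0} = 1 := by
  set g := Nat.setGcd {n | PseudoOrbit x r n 0 0}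
  have hg : ∀ {n}, PseudoOrbit x r n 0 0 → g ∣ n := fun h => Nat.setGcd_dvd_of_mem h
  refine Nat.dvd_one.1 (forall_of_forall_dist_lt_imp (s := (g ∣ ·)) hr hx
    (fun a b hab hga => ?_) (dvd_zero g) 1)
  rcases Nat.eq_zero_or_pos b with rfl | hb
  · exact dvd_zero g
  rcases Nat.eq_zero_or_pos a with rfl | ha
  · exact hg (pseudoOrbit_sub hr hb (by rwa [dist_comm]))
  · obtain ⟨l, hl⟩ := exists_pseudoOrbit hr hx b 0
    have hal : g ∣ a + l := hg ((pseudoOrbit_sub hr ha hab).trans hl)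
    have hbl : g ∣ b + l := hg (.trans (by simpa using pseudoOrbit_add hr b 0) hl)
    exact (Nat.dvd_add_left ((Nat.dvd_add_right hga).1 hal)).1 hbl

theorem eventually_pseudoOrbit_zero_zero (hr : 0 < r) (hx : DenseRange x) :
    ∀ᶠ n in atTop, PseudoOrbit x r n 0 0 := by
  obtain ⟨n₀, hn₀⟩ := Nat.exists_mem_closure_of_ge {n | PseudoOrbit x r n 0 0}
  filter_upwards [eventually_ge_atTop n₀] with n hn
  have hmem := hn₀ n hn (by rw [setGcd_pseudoOrbit hr hx]; exact one_dvd n)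
  clear hn
  induction hmem using AddSubmonoid.closure_induction with
  | mem _ h => exact h
  | zero => rfl
  | add _ _ _ _ h h' => exact h.trans h'

theorem eventually_pseudoOrbit (hr : 0 < r) (hx : DenseRange x) (i j : ℕ) :
    ∀ᶠ n in atTop, PseudoOrbit x r n i j := by
  obtain ⟨l, hl⟩ := exists_pseudoOrbit hr hx i 0
  obtain ⟨m, hm⟩ := exists_pseudoOrbit hr hx 0 j
  filter_upwards [eventually_ge_atTop (l + m),
    (tendsto_sub_atTop_nat (l + m)).eventually (eventually_pseudoOrbit_zero_zero hr hx)]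
    with n hn h
  convert (hl.trans h).trans hm using 1
  omega

end PseudoOrbit

/-! ### Doeblin's condition along a transitive map -/

section Comparison

variable {M ι : Type*} [MeasurableSpace M] {p : Kernel M M} {μ ν : Measure M}

theorem comp_mono (h : μ ≤ ν) : p ∘ₘ μ ≤ p ∘ₘ ν := by
  refine Measure.le_iff.2 fun A hA => ?_
  rw [Measure.bind_apply hA p.aemeasurable, Measure.bind_apply hA p.aemeasurable]
  exact lintegral_mono' h le_rfl

theorem comp_nnreal_smul (c : ℝ≥0) : p ∘ₘ (c • μ) = c • (p ∘ₘ μ) := Measure.comp_smul (c : ℝ≥0∞)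

theorem comp_le_smul {η : Measure M} (h : ∀ᵐ x ∂μ, p x ≤ η) : p ∘ₘ μ ≤ μ univ • η := by
  refine Measure.le_iff.2 fun A hA => ?_
  rw [Measure.bind_apply hA p.aemeasurable, Measure.smul_apply, smul_eq_mul, mul_comm,
    ← lintegral_const]
  exact lintegral_mono_ae (h.mono fun x hx => hx A)

theorem smul_le_comp {η : Measure M} (h : ∀ᵐ x ∂μ, η ≤ p x) : μ univ • η ≤ p ∘ₘ μ := by
  refine Measure.le_iff.2 fun A hA => ?_
  rw [Measure.bind_apply hA p.aemeasurable, Measure.smul_apply, smul_eq_mul, mul_comm,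
    ← lintegral_const]
  exact lintegral_mono_ae (h.mono fun x hx => hx A)

theorem exists_forall_smul_le {μ ν : ι → Measure M} (s : Finset ι)
    (h : ∀ i ∈ s, ∃ c : ℝ≥0, 0 < c ∧ c • μ i ≤ ν i) :
    ∃ c : ℝ≥0, 0 < c ∧ ∀ i ∈ s, c • μ i ≤ ν i := by
  induction s using Finset.cons_induction with
  | empty => exact ⟨1, one_pos, by simp⟩
  | cons i s _ ih =>
    obtain ⟨⟨c, hc, hci⟩, h⟩ := (Finset.forall_mem_cons _ _).1 h
    obtain ⟨d, hd, hds⟩ := ih h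
    refine ⟨min c d, lt_min hc hd, (Finset.forall_mem_cons _ _).2
      ⟨le_trans ?_ hci, fun j hj => le_trans ?_ (hds j hj)⟩⟩
    · gcongr; exact min_le_left c d
    · gcongr; exact min_le_right c d

theorem restrict_biUnion_finset_le (s : Finset ι) (B : ι → Set M) :
    μ.restrict (⋃ i ∈ s, B i) ≤ ∑ i ∈ s, μ.restrict (B i) := by
  induction s using Finset.cons_induction with
  | empty => simp
  | cons i s _ ih =>
    rw [Finset.sum_cons, ← Finset.set_biUnion_coe, Finset.coe_cons, biUnion_insert]
    exact (Measure.restrict_union_le _ _).trans (by gcongr; exact ih)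

theorem smul_le_card_smul_of_forall_restrict {s : Finset ι} {B : ι → Set M}
    (hs : ⋃ i ∈ s, B i = univ) {c : ℝ≥0} (h : ∀ i ∈ s, c • μ.restrict (B i) ≤ ν) :
    c • μ ≤ s.card • ν :=
  calc c • μ = c • μ.restrict (⋃ i ∈ s, B i) := by rw [hs, Measure.restrict_univ]
    _ ≤ c • ∑ i ∈ s, μ.restrict (B i) := by gcongr; exact restrict_biUnion_finset_le s B
    _ = ∑ i ∈ s, c • μ.restrict (B i) := Finset.smul_sum
    _ ≤ s.card • ν := Finset.sum_le_card_nsmul s _ ν h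

theorem absolutelyContinuous_of_invariant (hμ : p.Invariant μ) (h : ∀ᵐ x ∂μ, p x ≪ ν) :
    μ ≪ ν := by
  refine .mk fun A hA h0 => ?_
  rw [← hμ.def, Measure.bind_apply hA p.aemeasurable, lintegral_eq_zero_iff (p.measurable_coe hA)]
  exact h.mono fun x hx => hx h0

theorem isDoeblinKernel_of_reference [IsProbabilityMeasure μ] (hμ : p.Invariant μ) {N : ℕ}
    (hN : 0 < N) {c D : ℝ≥0} (hc : 0 < c) (hD : 0 < D) (hlow : ∀ᵐ x ∂μ, c • ν ≤ (p ^ N) x)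
    (hup : ∀ᵐ x ∂μ, p x ≤ D • ν) :
    IsDoeblinKernel p μ N (c / D) (D / c) := by
  have hμ_le : μ ≤ D • ν := by
    simpa [hμ.def] using comp_le_smul hup
  have hle_μ : c • ν ≤ μ := by
    simpa [(invariant_pow hμ N).def] using smul_le_comp hlow
  refine ⟨hμ, hlow.mono fun x hx => ?_, hup.mono fun x hx => ?_, hN,
    div_pos hc hD⟩
  · calc (c / D) • μ ≤ (c / D) • D • ν := by gcongr
      _ = c • ν := by rw [smul_smul, div_mul_cancel₀ c hD.ne']
      _ ≤ (p ^ N) x := hx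
  · calc p x ≤ D • ν := hx
      _ = (D / c) • c • ν := by rw [smul_smul, div_mul_cancel₀ D hc.ne']
      _ ≤ (D / c) • μ := by gcongr

end Comparison

namespace IsTransitiveOn

variable {M : Type*} [MetricSpace M] [MeasurableSpace M] [BorelSpace M] {Leb : Measure M}
  [IsFiniteMeasure Leb] [Leb.IsOpenPosMeasure] {f : M → M} {Y : Set M} {x₀ : M} {p : Kernel M M}
  {r : ℝ} {q : ℝ≥0}

theorem exists_smul_restrict_le_comp (hf : IsTransitiveOn Leb f Y x₀) (hr : 0 < r) (hq : 0 < q)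
    (hp : ∀ᵐ x ∂Leb, q • Leb.restrict (Metric.ball (f x) (r + r + r)) ≤ p x) {i j : ℕ}
    (hij : dist (f^[i + 1] x₀) (f^[j] x₀) < r) :
    ∃ c : ℝ≥0, 0 < c ∧ c • Leb.restrict (Metric.ball (f^[j] x₀) r) ≤
      p ∘ₘ Leb.restrict (Metric.ball (f^[i] x₀) r) := by
  obtain ⟨δ, hδ, hfδ⟩ := Metric.continuousOn_iff.1 hf.cont _ (hf.orbit_mem i) r hr
  set B := Metric.ball (f^[i] x₀) (min r δ)
  have hB : ∀ᵐ x ∂Leb.restrict B, q • Leb.restrict (Metric.ball (f^[j] x₀) r) ≤ p x := by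
    filter_upwards [ae_restrict_of_ae hf.full, ae_restrict_of_ae hp,
      ae_restrict_mem Metric.isOpen_ball.measurableSet] with x hxY hx hxB
    have hfx : dist (f x) (f (f^[i] x₀)) < r :=
      hfδ x hxY ((Metric.mem_ball.1 hxB).trans_le (min_le_right _ _))
    rw [← Function.iterate_succ_apply' f] at hfx
    refine le_trans ?_ hx
    gcongr
    refine Metric.ball_subset_ball' ?_
    rw [dist_comm]
    linarith [dist_triangle (f x) (f^[i + 1] x₀) (f^[j] x₀)]
  refine ⟨(Leb B).toNNReal * q, mul_pos (ENNReal.toNNReal_pos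
    (Metric.measure_ball_pos Leb _ (lt_min hr hδ)).ne' (measure_ne_top _ _)) hq, ?_⟩
  calc ((Leb B).toNNReal * q) • Leb.restrict (Metric.ball (f^[j] x₀) r)
      = (Leb.restrict B) univ • q • Leb.restrict (Metric.ball (f^[j] x₀) r) := by
        rw [mul_smul, Measure.restrict_apply_univ]
        conv_rhs => rw [← ENNReal.coe_toNNReal (measure_ne_top Leb B)]
        rfl
    _ ≤ p ∘ₘ Leb.restrict B := smul_le_comp hB
    _ ≤ _ := comp_mono (Measure.restrict_mono (Metric.ball_subset_ball (min_le_left _ _)) le_rfl)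

theorem exists_smul_restrict_le_pow_comp (hf : IsTransitiveOn Leb f Y x₀) (hr : 0 < r)
    (hq : 0 < q) (hp : ∀ᵐ x ∂Leb, q • Leb.restrict (Metric.ball (f x) (r + r + r)) ≤ p x)
    {n i j : ℕ} (hij : PseudoOrbit (fun n => f^[n] x₀) r n i j) :
    ∃ c : ℝ≥0, 0 < c ∧ c • Leb.restrict (Metric.ball (f^[j] x₀) r) ≤
      (p ^ n) ∘ₘ Leb.restrict (Metric.ball (f^[i] x₀) r) := by
  induction n generalizing i with
  | zero =>
    obtain rfl : i = j := hij
    exact ⟨1, one_pos, by rw [one_smul, pow_zero]; exact Measure.id_comp.ge⟩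
  | succ n ih =>
    obtain ⟨k, hik, hkj⟩ := hij
    obtain ⟨c, hc, hkj⟩ := ih hkj
    obtain ⟨d, hd, hik⟩ := hf.exists_smul_restrict_le_comp hr hq hp hik
    refine ⟨d * c, mul_pos hd hc, ?_⟩
    calc (d * c) • Leb.restrict (Metric.ball (f^[j] x₀) r)
        ≤ d • ((p ^ n) ∘ₘ Leb.restrict (Metric.ball (f^[k] x₀) r)) := by
          rw [mul_smul]; gcongr
      _ = (p ^ n) ∘ₘ (d • Leb.restrict (Metric.ball (f^[k] x₀) r)) := (comp_nnreal_smul d).symm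
      _ ≤ (p ^ n) ∘ₘ (p ∘ₘ Leb.restrict (Metric.ball (f^[i] x₀) r)) := comp_mono hik
      _ = _ := Measure.comp_assoc

theorem exists_smul_le_pow [CompactSpace M] [ConnectedSpace M] (hf : IsTransitiveOn Leb f Y x₀)
    {ρ : ℝ} (hρ : 0 < ρ) (hq : 0 < q)
    (hp : ∀ᵐ x ∂Leb, q • Leb.restrict (Metric.ball (f x) ρ) ≤ p x) :
    ∃ N > 0, ∃ c : ℝ≥0, 0 < c ∧ ∀ᵐ x ∂Leb, c • Leb ≤ (p ^ N) x := by
  obtain ⟨r, hr, rfl⟩ : ∃ r, 0 < r ∧ ρ = r + r + r := ⟨ρ / 3, by positivity, by ring⟩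
  obtain ⟨s, hs⟩ := exists_finset_iUnion_ball_eq_univ hf.orbit_dense hr
  obtain ⟨n, hn⟩ : ∃ n, ∀ a ∈ s ×ˢ s, PseudoOrbit (fun n => f^[n] x₀) r n a.1 a.2 :=
    ((s ×ˢ s).eventually_all.2 fun a _ => eventually_pseudoOrbit hr hf.orbit_dense _ _).exists
  obtain ⟨c, hc, hcs⟩ := exists_forall_smul_le (s ×ˢ s)
    fun a ha => hf.exists_smul_restrict_le_pow_comp hr hq hp (hn a ha)
  have hcard : 0 < s.card := by
    obtain ⟨i, hi, -⟩ := mem_iUnion₂.1 (hs ▸ mem_univ x₀)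
    exact Finset.card_pos.2 ⟨i, hi⟩
  refine ⟨n + 1, n.succ_pos, (s.card : ℝ≥0)⁻¹ * (q * c), by positivity, ?_⟩
  filter_upwards [hp] with x hx
  obtain ⟨i, his, hi⟩ := mem_iUnion₂.1 (hs ▸ mem_univ (f x))
  have hball : ∀ j ∈ s, (q * c) • Leb.restrict (Metric.ball (f^[j] x₀) r) ≤ (p ^ (n + 1)) x :=
    fun j hj => calc
      (q * c) • Leb.restrict (Metric.ball (f^[j] x₀) r)
        ≤ q • ((p ^ n) ∘ₘ Leb.restrict (Metric.ball (f^[i] x₀) r)) := by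
          rw [mul_smul]; gcongr; exact hcs (i, j) (Finset.mk_mem_product his hj)
      _ = (p ^ n) ∘ₘ (q • Leb.restrict (Metric.ball (f^[i] x₀) r)) := (comp_nnreal_smul q).symm
      _ ≤ (p ^ n) ∘ₘ p x := comp_mono <| le_trans (by
          gcongr
          refine Metric.ball_subset_ball' ?_
          linarith [Metric.mem_ball'.1 hi]) hx
      _ = (p ^ (n + 1)) x := (Kernel.comp_apply (p ^ n) p x).symm
  calc ((s.card : ℝ≥0)⁻¹ * (q * c)) • Leb
      ≤ (s.card : ℝ≥0)⁻¹ • s.card • (p ^ (n + 1)) x := by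
        rw [mul_smul]; gcongr; exact smul_le_card_smul_of_forall_restrict hs hball
    _ = (p ^ (n + 1)) x := by
        rw [← Nat.cast_smul_eq_nsmul ℝ≥0, smul_smul, inv_mul_cancel₀ (by positivity), one_smul]

end IsTransitiveOn

section WithDensity

variable {M : Type*} [MeasurableSpace M] {m : Measure M} {g : M → ℝ≥0∞} {c : ℝ≥0} {s : Set M}

theorem smul_restrict_le_withDensity (hs : MeasurableSet s) (h : ∀ᵐ y ∂m, y ∈ s → c ≤ g y) :
    c • m.restrict s ≤ m.withDensity g :=
  calc c • m.restrict s = (m.restrict s).withDensity fun _ => (c : ℝ≥0∞) :=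
        (withDensity_const (c : ℝ≥0∞)).symm
    _ ≤ (m.restrict s).withDensity g := withDensity_mono ((ae_restrict_iff' hs).2 h)
    _ = (m.withDensity g).restrict s := (restrict_withDensity hs g).symm
    _ ≤ m.withDensity g := Measure.restrict_le_self

theorem withDensity_le_smul (hs : MeasurableSet s) (hs' : ∀ᵐ y ∂m.withDensity g, y ∈ s)
    (h : ∀ᵐ y ∂m, y ∈ s → g y ≤ c) : m.withDensity g ≤ c • m :=
  calc m.withDensity g
    _ = (m.withDensity g).restrict s := (Measure.restrict_eq_self_of_ae_mem hs').symm
    _ = (m.restrict s).withDensity g := restrict_withDensity hs g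
    _ ≤ (m.restrict s).withDensity fun _ => (c : ℝ≥0∞) :=
      withDensity_mono ((ae_restrict_iff' hs).2 h)
    _ = c • m.restrict s := withDensity_const (c : ℝ≥0∞)
    _ ≤ c • m := by gcongr; exact Measure.restrict_le_self

end WithDensity

/-! ### Random maps -/

section RandomMaps

variable {M X : Type*} [MeasurableSpace M] [MeasurableSpace X] {F : M → X → M}
  {θ : Measure X} [IsProbabilityMeasure θ] {μ : Measure M} [IsProbabilityMeasure μ]

/-- The transition kernel `x ↦ (F x)_* θ` of the random maps `F · ω`, where `ω` has law `θ`. -/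
noncomputable def randomKernel (F : M → X → M) (θ : Measure X) : Kernel M M :=
  (Kernel.id ×ₖ Kernel.const M θ).map (Function.uncurry F)

theorem randomKernel_apply (hF : Measurable (Function.uncurry F)) (x : M) :
    randomKernel F θ x = θ.map (F x) := by
  rw [randomKernel, Kernel.map_apply _ hF, Kernel.prod_apply, Kernel.id_apply, Kernel.const_apply,
    Measure.dirac_prod, Measure.map_map hF measurable_prodMk_left]
  rfl

theorem isMarkovKernel_randomKernel (hF : Measurable (Function.uncurry F)) :
    IsMarkovKernel (randomKernel F θ) :=
  Kernel.IsMarkovKernel.map _ hF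

theorem randomKernel_comp (hF : Measurable (Function.uncurry F)) :
    randomKernel F θ ∘ₘ μ = (μ.prod θ).map (Function.uncurry F) := by
  rw [randomKernel, ← Measure.map_comp _ _ hF, ← Measure.compProd_eq_comp_prod,
    Measure.compProd_const]

theorem IsStationary.invariant (hμ : IsStationary F θ μ) (hF : Measurable (Function.uncurry F)) :
    (randomKernel F θ).Invariant μ := by
  have : IsProbabilityMeasure ((μ.prod θ).map (Function.uncurry F)) :=
    Measure.isProbabilityMeasure_map hF.aemeasurable
  refine (randomKernel_comp hF).trans (Measure.ext fun A hA =>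
    (measureReal_eq_measureReal_iff).1 ?_)
  have hA1 : BddMeas (A.indicator (1 : M → ℝ)) := .indicator_one hA
  calc ((μ.prod θ).map (Function.uncurry F)).real A
      = ∫ z, A.indicator 1 (Function.uncurry F z) ∂μ.prod θ := by
        rw [← integral_indicator_one hA,
          integral_map hF.aemeasurable hA1.1.aestronglyMeasurable]
    _ = ∫ ω, ∫ x, A.indicator 1 (F x ω) ∂μ ∂θ :=
        integral_prod_symm _ ((hA1.comp hF).integrable _)
    _ = μ.real A := by rw [hμ _ (hA1.integrable μ), integral_indicator_one hA]

theorem measurable_randomOrbit (hF : Measurable (Function.uncurry F)) (n : ℕ) :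
    Measurable fun z : M × (ℕ → X) => randomOrbit F z.1 z.2 n := by
  induction n with
  | zero => exact measurable_fst
  | succ n ih => exact hF.comp (ih.prodMk ((measurable_pi_apply n).comp measurable_snd))

omit [MeasurableSpace M] [MeasurableSpace X] in
theorem randomOrbit_congr (x : M) {ω ω' : ℕ → X} {n : ℕ} (h : ∀ i < n, ω i = ω' i) :
    randomOrbit F x ω n = randomOrbit F x ω' n := by
  induction n with
  | zero => rfl
  | succ n ih =>
    rw [randomOrbit, randomOrbit, ih fun i hi => h i (hi.trans n.lt_succ_self),
      h n n.lt_succ_self]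

theorem indepFun_randomOrbit (hF : Measurable (Function.uncurry F)) (x : M) (n : ℕ) :
    IndepFun (fun (ω : ℕ → X) (i : Fin (n + 1)) => randomOrbit F x ω i) (fun ω => ω n)
      (Measure.infinitePi fun _ : ℕ => θ) := by
  obtain ⟨a⟩ := θ.nonempty_of_neZero
  have hind : iIndepFun (fun (i : ℕ) (ω : ℕ → X) => ω i) (Measure.infinitePi fun _ : ℕ => θ) :=
    iIndepFun_infinitePi (X := fun _ x => x) fun _ => measurable_id
  have hpast := hind.indepFun_finset (Finset.range n) {n} (by simp) measurable_pi_apply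
  have hext (i : Fin (n + 1)) : Measurable fun v : Finset.range n → X =>
      randomOrbit F x (Function.updateFinset (fun _ => a) _ v) i :=
    (measurable_randomOrbit hF i).comp (measurable_const.prodMk measurable_updateFinset)
  convert hpast.comp (measurable_pi_lambda _ hext)
    (measurable_pi_apply (⟨n, Finset.mem_singleton_self n⟩ : ({n} : Finset ℕ))) using 1
  · ext ω i
    refine randomOrbit_congr x fun j hj => ?_
    simp [Function.updateFinset, hj.trans_le (Nat.le_of_lt_succ i.2)]
  · rfl

theorem indepFun_prod_of_forall {Ω α β : Type*} [MeasurableSpace Ω] [MeasurableSpace α]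
    [MeasurableSpace β] {ν : Measure Ω} [IsProbabilityMeasure ν] {T : M → Ω → α} {ξ : Ω → β}
    (hT : Measurable (Function.uncurry T)) (hξ : Measurable ξ)
    (h : ∀ x, IndepFun (T x) ξ ν) :
    IndepFun (Function.uncurry T) (fun z => ξ z.2) (μ.prod ν) := by
  refine indepFun_iff_measure_inter_preimage_eq_mul.2 fun B A hB hA => ?_
  have hA' : MeasurableSet ((fun z : M × Ω => ξ z.2) ⁻¹' A) := (hξ.comp measurable_snd) hA
  have hμA : μ.prod ν ((fun z : M × Ω => ξ z.2) ⁻¹' A) = ν (ξ ⁻¹' A) := by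
    rw [Measure.prod_apply hA']
    simp [preimage_preimage]
  rw [hμA, Measure.prod_apply ((hT hB).inter hA'), Measure.prod_apply (hT hB),
    ← lintegral_mul_const _ (measurable_measure_prodMk_left (hT hB))]
  exact lintegral_congr fun x => (h x).measure_inter_preimage_eq_mul _ _ hB hA

theorem isMarkovChain_of_indepFun {Ω : Type*} [MeasurableSpace Ω] {P : Measure Ω}
    [IsProbabilityMeasure P] {Z : ℕ → Ω → M} {ξ : ℕ → Ω → X}
    (hF : Measurable (Function.uncurry F)) (hZ : ∀ n, Measurable (Z n))
    (hξ : ∀ n, Measurable (ξ n)) (hθ : ∀ n, P.map (ξ n) = θ)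
    (hstep : ∀ n ω, Z (n + 1) ω = F (Z n ω) (ξ n ω))
    (hind : ∀ n, IndepFun (fun ω (i : Fin (n + 1)) => Z i ω) (ξ n) P) :
    IsMarkovChain P (randomKernel F θ) (P.map (Z 0)) Z where
  measurable := hZ
  initial := rfl
  transition n B A hB hA := by
    set T : Ω → Fin (n + 1) → M := fun ω i => Z i ω
    have hT : Measurable T := measurable_pi_lambda _ fun i => hZ i
    have hG : Measurable fun a : (Fin (n + 1) → M) × X => F (a.1 (Fin.last n)) a.2 :=
      hF.comp (f := fun a : (Fin (n + 1) → M) × X => (a.1 (Fin.last n), a.2)) (by fun_prop)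
    have hk : Measurable fun v : Fin (n + 1) → M => randomKernel F θ (v (Fin.last n)) A :=
      (Kernel.measurable_coe _ hA).comp (measurable_pi_apply _)
    have hlaw : P.map (fun ω => (T ω, ξ n ω)) = (P.map T).prod θ := by
      rw [(indepFun_iff_map_prod_eq_prod_map_map hT.aemeasurable (hξ n).aemeasurable).1 (hind n),
        hθ n]
    set D : Set ((Fin (n + 1) → M) × X) := {a | a.1 ∈ B ∧ F (a.1 (Fin.last n)) a.2 ∈ A}
    have hD : MeasurableSet D := (measurable_fst hB).inter (hG hA)
    have hsection (v : Fin (n + 1) → M) : θ (Prod.mk v ⁻¹' D) =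
        B.indicator (fun v => randomKernel F θ (v (Fin.last n)) A) v := by
      by_cases hv : v ∈ B
      · rw [indicator_of_mem hv, randomKernel_apply hF, Measure.map_apply hF.of_uncurry_left hA]
        simp [D, hv, preimage]
      · simp [D, hv]
    calc P {ω | T ω ∈ B ∧ Z (n + 1) ω ∈ A}
        = P.map (fun ω => (T ω, ξ n ω)) D := by
          rw [Measure.map_apply (hT.prodMk (hξ n)) hD]
          simp only [hstep]
          rfl
      _ = ∫⁻ v, B.indicator (fun v => randomKernel F θ (v (Fin.last n)) A) v ∂P.map T := by
          rw [hlaw, Measure.prod_apply hD]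
          simp only [hsection]
      _ = ∫⁻ ω in {ω | T ω ∈ B}, randomKernel F θ (Z n ω) A ∂P := by
          rw [lintegral_indicator hB, setLIntegral_map hB hk hT]
          rfl

theorem isMarkovChain_randomOrbit (hF : Measurable (Function.uncurry F)) :
    IsMarkovChain (annealedMeasure μ θ) (randomKernel F θ) μ
      (fun n z => randomOrbit F z.1 z.2 n) := by
  have h := isMarkovChain_of_indepFun (P := annealedMeasure μ θ) (θ := θ)
    (ξ := fun n (z : M × (ℕ → X)) => z.2 n) hF (measurable_randomOrbit hF)
    (fun n => (measurable_pi_apply n).comp measurable_snd) (fun n => ?_) (fun _ _ => rfl)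
    (fun n => indepFun_prod_of_forall
      (T := fun x ω (i : Fin (n + 1)) => randomOrbit F x ω i) (ξ := fun ω => ω n)
      (measurable_pi_lambda _ fun i => measurable_randomOrbit hF i) (measurable_pi_apply n)
      fun x => indepFun_randomOrbit hF x n)
  · rwa [show (annealedMeasure μ θ).map (fun z => randomOrbit F z.1 z.2 0) = μ from
      Measure.map_fst_prod.trans (by simp)] at h
  · exact ((measurePreserving_eval_infinitePi (fun _ : ℕ => θ) n).comp
      measurePreserving_snd).map_eq

end RandomMaps

/-! ### The two families of perturbations -/

theorem IsUniformRandomPerturbation.exists_isDoeblinKernel {M X : Type*} [MetricSpace M]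
    [CompactSpace M] [ConnectedSpace M] [MeasurableSpace M] [BorelSpace M] [MetricSpace X]
    [MeasurableSpace X] {Leb : Measure M} [IsFiniteMeasure Leb] [Leb.IsOpenPosMeasure] {f : M → M}
    {Y : Set M} {x₀ : M} (hf : IsTransitiveOn Leb f Y x₀) {F : M → X → M} {θ : Measure X}
    [IsProbabilityMeasure θ] {ωstar : X} (hF : IsUniformRandomPerturbation Leb f F θ ωstar)
    {μ : Measure M} [IsProbabilityMeasure μ] (hac : ∀ᵐ x ∂μ, θ.map (F x) ≪ Leb)
    (hμ : IsStationary F θ μ) :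
    ∃ N c C, IsDoeblinKernel (randomKernel F θ) μ N c C := by
  obtain ⟨ρ, hρ, hcov⟩ := hF.covers
  obtain ⟨qlo, qhi, hlo, hlohi, hdens⟩ := hF.density
  lift qlo to ℝ≥0 using hlo.le
  lift qhi to ℝ≥0 using (hlo.trans hlohi).le
  simp only [← randomKernel_apply hF.measurable] at hcov hdens hac
  have hlow : ∀ᵐ x ∂Leb, qlo • Leb.restrict (Metric.ball (f x) ρ) ≤ randomKernel F θ x := by
    filter_upwards [hcov, hdens] with x hx ⟨q, _, hqx, hq⟩
    rw [hqx] at hx hq ⊢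
    exact smul_restrict_le_withDensity Metric.isOpen_ball.measurableSet
      (hq.mono fun y hy hyB => by exact_mod_cast (hy (hx hyB)).1)
  have hup : ∀ᵐ x ∂Leb, randomKernel F θ x ≤ qhi • Leb := by
    filter_upwards [hdens] with x ⟨q, _, hqx, hq⟩
    rw [hqx] at hq ⊢
    exact withDensity_le_smul Measure.isClosed_support.measurableSet Measure.support_mem_ae
      (hq.mono fun y hy hyS => by exact_mod_cast (hy hyS).2)
  have hinv := hμ.invariant hF.measurable
  have hac : μ ≪ Leb := absolutelyContinuous_of_invariant hinv hac
  obtain ⟨N, hN, c, hc, hpow⟩ := hf.exists_smul_le_pow hρ hlo hlow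
  exact ⟨N, _, _, isDoeblinKernel_of_reference hinv hN hc (hlo.trans hlohi) (hac.ae_le hpow)
    (hac.ae_le hup)⟩

theorem IsMarkovPerturbation.exists_isDoeblinKernel {M : Type*} [MetricSpace M]
    [MeasurableSpace M] {Leb : Measure M} {f : M → M} {Y : Set M} (hY : ∀ᵐ x ∂Leb, x ∈ Y)
    {p : Kernel M M} (hp : IsMarkovPerturbation Leb f Y p) {μ : Measure M}
    [IsProbabilityMeasure μ] (hμ : p.Invariant μ) :
    ∃ N c C, IsDoeblinKernel p μ N c C := by
  obtain ⟨q, -, hpq, -, -, qlo, qhi, hlo, hlohi, hq⟩ := hp.density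
  lift qlo to ℝ≥0 using hlo.le
  lift qhi to ℝ≥0 using (hlo.trans hlohi).le
  have hac : μ ≪ Leb := absolutelyContinuous_of_invariant hμ
    (ae_of_all _ fun x => hpq x ▸ withDensity_absolutelyContinuous _ _)
  have hlow : ∀ᵐ x ∂Leb, qlo • Leb ≤ (p ^ 1) x := by
    filter_upwards [hY] with x hx
    rw [pow_one, hpq]
    simpa using smul_restrict_le_withDensity .univ
      (ae_of_all Leb fun y _ => ENNReal.ofReal_coe_nnreal.symm.trans_le
        (ENNReal.ofReal_le_ofReal (hq x hx y).1))
  have hup : ∀ᵐ x ∂Leb, p x ≤ qhi • Leb := by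
    filter_upwards [hY] with x hx
    rw [hpq]
    exact withDensity_le_smul .univ (ae_of_all _ fun _ => mem_univ _)
      (ae_of_all Leb fun y _ => ENNReal.ofReal_le_coe.2 (hq x hx y).2)
  exact ⟨1, _, _, isDoeblinKernel_of_reference hμ one_pos hlo (hlo.trans hlohi) (hac.ae_le hlow)
    (hac.ae_le hup)⟩

theorem IsVolumeMeasure.isOpenPosMeasure {d : ℕ} {M : Type*} [TopologicalSpace M]
    [MeasurableSpace M] [BorelSpace M] [ChartedSpace (EuclideanSpace ℝ (Fin d)) M] {m : Measure M}
    (hm : IsVolumeMeasure (d := d) m) : m.IsOpenPosMeasure := by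
  refine ⟨fun U hU ⟨x, hx⟩ h0 => ?_⟩
  obtain ⟨ρ, hρ, hρ0, hmap⟩ := hm x
  set e := chartAt (EuclideanSpace ℝ (Fin d)) x
  set W := e.target ∩ e.symm ⁻¹' U
  have hW : IsOpen W := e.isOpen_inter_preimage_symm hU
  have hxW : e x ∈ W :=
    ⟨e.map_source (mem_chart_source _ x), by
      rwa [mem_preimage, e.left_inv (mem_chart_source _ x)]⟩
  have hmapW : (m.restrict e.source).map e W = 0 := by
    rw [Measure.map_apply_of_aemeasurable
      (e.continuousOn.aemeasurable e.open_source.measurableSet) hW.measurableSet,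
      Measure.restrict_apply' e.open_source.measurableSet]
    exact measure_mono_null (fun y hy => e.left_inv hy.2 ▸ hy.1.2) h0
  have hρm : AEMeasurable (fun y => ENNReal.ofReal (ρ y)) (volume.restrict e.target) :=
    (hρ.aemeasurable e.open_target.measurableSet).ennreal_ofReal
  rw [hmap, withDensity_apply_eq_zero' hρm,
    Measure.restrict_apply' e.open_target.measurableSet] at hmapW
  refine hW.measure_ne_zero volume ⟨_, hxW⟩ (measure_mono_null (fun y hy => ?_) hmapW)
  exact ⟨⟨(ENNReal.ofReal_pos.2 (hρ0 y hy.1)).ne', hy⟩, hy.1⟩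

end RareEvents

theorem corollaryE_general {M : Type a} [MetricSpace M] [CompactSpace M] [ConnectedSpace M]
    [MeasurableSpace M] [BorelSpace M]
    (Leb : Measure M) [IsFiniteMeasure Leb] [Leb.IsOpenPosMeasure]
    (f : M → M) (Y : Set M) (x₀ : M) (hf : IsTransitiveOn Leb f Y x₀)
    (μ : Measure M) [IsProbabilityMeasure μ] (φ : M → EReal) (hφ : Measurable φ)
    (u : ℕ → ℝ) (τ : ℝ) (hτ : 0 < τ)
    (hu : Tendsto (fun n : ℕ => (n : ℝ) * μ.real {x | (u n : EReal) < φ x}) atTop (𝓝 τ)) :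
    (∀ (X : Type b) [MetricSpace X] [MeasurableSpace X]
      (θ : Measure X) [IsProbabilityMeasure θ] (ωstar : X) (F : M → X → M),
      IsUniformRandomPerturbation Leb f F θ ωstar →
      (∀ᵐ x ∂μ, θ.map (F x) ≪ Leb) →
      IsStationary F θ μ →
      HasPoissonRareEvents.{v} (annealedMeasure μ θ)
        (fun n (z : M × (ℕ → X)) => φ (randomOrbit F z.1 z.2 n)) u) ∧
    (∀ (p : Kernel M M) [IsMarkovKernel p],
      IsMarkovPerturbation Leb f Y p →
      p.Invariant μ →
      ∀ (Ω : Type c) [MeasurableSpace Ω] (P : Measure Ω) [IsProbabilityMeasure P]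
        (Z : ℕ → Ω → M), IsMarkovChain P p μ Z →
        HasPoissonRareEvents.{v} P (fun n ω => φ (Z n ω)) u) := by
  refine ⟨fun X _ _ θ _ ωstar F hF hac hμ => ?_, fun p _ hp hμ Ω _ P _ Z hZ => ?_⟩
  · have := isMarkovKernel_randomKernel (θ := θ) hF.measurable
    obtain ⟨N, c, C, hD⟩ := hF.exists_isDoeblinKernel hf hac hμ
    exact (isMarkovChain_randomOrbit hF.measurable).hasPoissonRareEvents hD hφ hτ hu
  · obtain ⟨N, c, C, hD⟩ := hp.exists_isDoeblinKernel hf.full hμ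
    exact hZ.hasPoissonRareEvents hD hφ hτ hu

theorem corollaryE {d : ℕ} {M : Type a} [MetricSpace M] [CompactSpace M]
    [ConnectedSpace M]
    [ChartedSpace (EuclideanSpace ℝ (Fin d)) M] [IsManifold (𝓡 d) (⊤ : ℕ∞) M]
    [Bundle.RiemannianBundle (fun x : M => TangentSpace (𝓡 d) x)]
    [IsContMDiffRiemannianBundle (𝓡 d) (⊤ : ℕ∞) (EuclideanSpace ℝ (Fin d))
      (fun x : M => TangentSpace (𝓡 d) x)]
    [IsRiemannianManifold (𝓡 d) M]
    [MeasurableSpace M] [BorelSpace M]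
    (Leb : Measure M) [IsProbabilityMeasure Leb] (hLeb : IsVolumeMeasure (d := d) Leb)
    (f : M → M) (Y : Set M) (x₀ : M) (hf : IsTransitiveOn Leb f Y x₀)
    (μ : Measure M) [IsProbabilityMeasure μ]
    (φ : M → EReal) (ζ : M) (hφ : IsRegularObservable d μ φ ζ)
    (u : ℕ → ℝ) (τ : ℝ) (hτ : 0 < τ)
    (hu : Tendsto (fun n : ℕ => (n : ℝ) * μ.real {x | (u n : EReal) < φ x}) atTop (𝓝 τ)) :
    (∀ (X : Type b) [MetricSpace X] [CompactSpace X] [MeasurableSpace X] [BorelSpace X]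
      (θ : Measure X) [IsProbabilityMeasure θ] (ωstar : X) (F : M → X → M),
      IsUniformRandomPerturbation Leb f F θ ωstar →
      (∀ᵐ x ∂μ, θ.map (F x) ≪ Leb) →
      IsStationary F θ μ →
      HasPoissonRareEvents.{v} (annealedMeasure μ θ)
        (fun n (z : M × (ℕ → X)) => φ (randomOrbit F z.1 z.2 n)) u) ∧
    (∀ (p : Kernel M M) [IsMarkovKernel p],
      IsMarkovPerturbation Leb f Y p →
      p.Invariant μ →
      ∀ (Ω : Type c) [MeasurableSpace Ω] (P : Measure Ω) [IsProbabilityMeasure P]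
        (Z : ℕ → Ω → M), IsMarkovChain P p μ Z →
        HasPoissonRareEvents.{v} P (fun n ω => φ (Z n ω)) u) := by
  have := hLeb.isOpenPosMeasure
  have h := corollaryE_general Leb f Y x₀ hf μ φ hφ.measurable u τ hτ hu
  exact ⟨fun X _ _ _ _ θ _ ωstar F => h.1 X θ ωstar F, h.2⟩
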